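/- Let $r$ be a positive integer. Put $\Gamma=GL_r(\mathbb Z)$ and $\Delta=M_r(\mathbb Z)\cap GL_r(\mathbb Q)$; for each prime $p$ put $\Gamma_p=GL_r(\mathbb Z_p)$ and $\Delta_p=M_r(\mathbb Z_p)\cap GL_r(\mathbb Q_p)$; let $\widehat\Gamma=\prod_p\Gamma_p$, and let $\widehat\Delta$ be the restricted product of the monoids $\Delta_p$ with respect to the subgroups $\Gamma_p$. Let $R_{\mathbb Z^r}$ and $\widehat R_{\mathbb Z^r}$ be the Hecke rings (with coefficients in $\mathbb Z$) of the pairs $(\Gamma,\Delta)$ and $(\widehat\Gamma,\widehat\Delta)$: the free abelian groups on the double cosets $\Gamma\alpha\Gamma$ ($\alpha\in\Delta$), respectively $\widehat\Gamma\widehat\alpha\widehat\Gamma$ ($\widehat\alpha\in\widehat\Delta$), in which the coefficient of $\Gamma\xi\Gamma$ in the product $(\Gamma\alpha\Gamma)(\Gamma\beta\Gamma)$ is the number of cosets $\Gamma b\subseteq\Gamma\beta\Gamma$ with $\xi b^{-1}\in\Gamma\alpha\Gamma$, and likewise for $\widehat R_{\mathbb Z^r}$. Let $\eta:\Delta\to\widehat\Delta$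 be the diagonal embedding, and let $\eta^*:\widehat R_{\mathbb Z^r}\to R_{\mathbb Z^r}$ be the additive map that sends $\widehat\Gamma\widehat\alpha\widehat\Gamma$ to the sum of the finitely many distinct double cosets $\Gamma\alpha\Gamma$ ($\alpha\in\Delta$) with $\eta(\alpha)\in\widehat\Gamma\widehat\alpha\widehat\Gamma$. Then $\eta^*$ is an isomorphism of rings. -/

import Mathlib

/-! ## The Hecke ring of a pair `(Γ, Δ)` -/

namespace HeckePair

open scoped Pointwise

variable {G : Type*} [Group G]

/-- The right coset space `Γ\G = {Γg}`. -/
abbrev RightCosets (Γ : Subgroup G) : Type _ := Quotient (QuotientGroup.rightRel Γ)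

/-- The coset `Γg`. -/
def cosetMk (Γ : Subgroup G) (g : G) : RightCosets Γ := Quotient.mk _ g

/-- `∑ φ(b)`, over representatives `b` of the cosets `Γb` in `Γ\G`. -/
noncomputable def cosetSum (Γ : Subgroup G) (φ : G → ℤ) : ℤ :=
  ∑ᶠ c : RightCosets Γ, φ c.out

/-- The convolution `(f * h)(ξ) = ∑_{Γb ∈ Γ\G} f(ξ b⁻¹) h(b)`. -/
noncomputable def conv (Γ : Subgroup G) (f h : G → ℤ) (ξ : G) : ℤ :=
  cosetSum Γ fun b => f (ξ * b⁻¹) * h b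

/-- `Γ`-bi-invariant functions supported on a subset of `Δ` that is a union of finitely many
cosets `Γg`. -/
structure IsHecke (Δ : Submonoid G) (Γ : Subgroup G) (f : G → ℤ) : Prop where
  supp : ∀ g, f g ≠ 0 → g ∈ Δ
  left : ∀ γ ∈ Γ, ∀ g, f (γ * g) = f g
  right : ∀ γ ∈ Γ, ∀ g, f (g * γ) = f g
  finite : {c : RightCosets Γ | f c.out ≠ 0}.Finite

open Classical in
/-- The function on `G` attached to an element of the Hecke ring: on `g ∈ Δ` its value is the
coefficient of `ΓgΓ`, and it vanishes outside `Δ`. -/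
noncomputable def toFun {Δ : Submonoid G} {Γ : Subgroup G} (F : HeckeRing Δ Γ ℤ) (g : G) : ℤ :=
  if h : g ∈ Δ then F (HeckeCoset.mk Γ Γ ⟨g, h⟩) else 0

section lemmas

variable {Δ : Submonoid G} {Γ : Subgroup G}

theorem out_mk (g : G) : ∃ γ ∈ Γ, (cosetMk Γ g).out = γ * g := by
  have h : QuotientGroup.rightRel Γ (cosetMk Γ g).out g := Quotient.mk_out g
  rw [QuotientGroup.rightRel_apply] at h
  exact ⟨_, Γ.inv_mem h, by group⟩

theorem cosetMk_eq {a b : G} : cosetMk Γ a = cosetMk Γ b ↔ b * a⁻¹ ∈ Γ := by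
  rw [← QuotientGroup.rightRel_apply]
  exact Quotient.eq

theorem cosetMk_out (c : RightCosets Γ) : cosetMk Γ c.out = c := Quotient.out_eq c

theorem apply_out {φ : G → ℤ} (hφ : ∀ γ ∈ Γ, ∀ g, φ (γ * g) = φ g) (g : G) :
    φ (cosetMk Γ g).out = φ g := by
  obtain ⟨γ, hγ, h⟩ := out_mk (Γ := Γ) g
  rw [h, hφ γ hγ]

/-- Right translation by `x` on `Γ\G`. -/
noncomputable def translate (Γ : Subgroup G) (x : G) : RightCosets Γ ≃ RightCosets Γ where
  toFun c := cosetMk Γ (c.out * x)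
  invFun c := cosetMk Γ (c.out * x⁻¹)
  left_inv c := by
    obtain ⟨γ, hγ, h⟩ := out_mk (Γ := Γ) (c.out * x)
    dsimp only
    rw [h]
    conv_rhs => rw [← cosetMk_out c]
    rw [cosetMk_eq]
    simpa [mul_assoc] using hγ
  right_inv c := by
    obtain ⟨γ, hγ, h⟩ := out_mk (Γ := Γ) (c.out * x⁻¹)
    dsimp only
    rw [h]
    conv_rhs => rw [← cosetMk_out c]
    rw [cosetMk_eq]
    simpa [mul_assoc] using hγ

theorem cosetSum_translate {φ : G → ℤ} (hφ : ∀ γ ∈ Γ, ∀ g, φ (γ * g) = φ g) (x : G) :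
    cosetSum Γ (fun b => φ (b * x)) = cosetSum Γ φ := by
  unfold cosetSum
  rw [← finsum_comp_equiv (translate Γ x) (f := fun c => φ c.out)]
  refine finsum_congr fun c => ?_
  exact (apply_out hφ _).symm

variable {f h k : G → ℤ}

theorem IsHecke.summand (hf : IsHecke Δ Γ f) (hh : IsHecke Δ Γ h) (ξ : G) :
    ∀ γ ∈ Γ, ∀ b, f (ξ * (γ * b)⁻¹) * h (γ * b) = f (ξ * b⁻¹) * h b := by
  intro γ hγ b
  rw [hh.left γ hγ, mul_inv_rev, ← mul_assoc, hf.right _ (Γ.inv_mem hγ)]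

theorem conv_eq_sum (hh : IsHecke Δ Γ h) (f : G → ℤ) (ξ : G) :
    conv Γ f h ξ = ∑ c ∈ hh.finite.toFinset, f (ξ * c.out⁻¹) * h c.out := by
  unfold conv cosetSum
  refine finsum_eq_sum_of_support_subset _ fun c hc => ?_
  simp only [Function.mem_support] at hc
  simpa using right_ne_zero_of_mul hc

theorem IsHecke.conv (hf : IsHecke Δ Γ f) (hh : IsHecke Δ Γ h) :
    IsHecke Δ Γ (conv Γ f h) where
  supp ξ hξ := by
    rw [conv_eq_sum hh] at hξ
    obtain ⟨c, -, hc⟩ := Finset.exists_ne_zero_of_sum_ne_zero hξ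
    have := Δ.mul_mem (hf.supp _ (left_ne_zero_of_mul hc)) (hh.supp _ (right_ne_zero_of_mul hc))
    simpa using this
  left γ hγ ξ := by
    unfold HeckePair.conv
    congr 1
    funext b
    rw [mul_assoc, hf.left γ hγ]
  right γ hγ ξ := by
    unfold HeckePair.conv
    rw [← cosetSum_translate (hf.summand hh _) γ]
    congr 1
    funext b
    rw [hh.right γ hγ]
    congr 2
    group
  finite := by
    refine ((hf.finite.prod hh.finite).image
      fun x => cosetMk Γ (x.1.out * x.2.out)).subset fun c hc => ?_
    simp only [Set.mem_ofPred_eq] at hc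
    rw [conv_eq_sum hh] at hc
    obtain ⟨d, -, hd⟩ := Finset.exists_ne_zero_of_sum_ne_zero hc
    refine ⟨(cosetMk Γ (c.out * d.out⁻¹), d), ⟨?_, right_ne_zero_of_mul hd⟩, ?_⟩
    · simp only [Set.mem_ofPred_eq]
      rw [apply_out hf.left]
      exact left_ne_zero_of_mul hd
    · obtain ⟨γ, hγ, e⟩ := out_mk (Γ := Γ) (c.out * d.out⁻¹)
      simp only [e]
      conv_rhs => rw [← cosetMk_out c]
      rw [cosetMk_eq]
      simpa [mul_assoc] using hγ

theorem conv_assoc (hf : IsHecke Δ Γ f) (hh : IsHecke Δ Γ h) (hk : IsHecke Δ Γ k) :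
    conv Γ (conv Γ f h) k = conv Γ f (conv Γ h k) := by
  funext ξ
  rw [conv_eq_sum hk]
  have key : ∀ c : RightCosets Γ, conv Γ f h (ξ * c.out⁻¹) * k c.out =
      ∑ᶠ e : RightCosets Γ, f (ξ * e.out⁻¹) * (h (e.out * c.out⁻¹) * k c.out) := by
    intro c
    have h1 : conv Γ f h (ξ * c.out⁻¹) =
        cosetSum Γ fun b => f (ξ * b⁻¹) * h (b * c.out⁻¹) := by
      rw [← cosetSum_translate (φ := fun b => f (ξ * b⁻¹) * h (b * c.out⁻¹)) _ c.out]
      · unfold conv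
        congr 1
        funext b
        simp [mul_assoc]
      · intro γ hγ g
        rw [mul_assoc γ, hh.left γ hγ, mul_inv_rev, ← mul_assoc, hf.right _ (Γ.inv_mem hγ)]
    rw [h1]
    unfold cosetSum
    rw [finsum_mul]
    simp only [mul_assoc]
  rw [Finset.sum_congr rfl fun c _ => key c, ← finsum_sum_comm]
  · unfold conv cosetSum
    refine finsum_congr fun e => ?_
    rw [← Finset.mul_sum]
    congr 1
    exact (conv_eq_sum hk h e.out).symm
  · intro c hc
    refine (hh.finite.image (translate Γ c.out)).subset fun e he => ?_
    simp only [Function.mem_support] at he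
    have he' := left_ne_zero_of_mul (right_ne_zero_of_mul he)
    refine ⟨cosetMk Γ (e.out * c.out⁻¹), ?_, ?_⟩
    · simp only [Set.mem_ofPred_eq]
      rwa [apply_out hh.left]
    · exact (translate Γ c.out).apply_symm_apply e

open Classical in
theorem one_conv (hf : IsHecke Δ Γ f) :
    conv Γ (fun g => if g ∈ Γ then 1 else 0) f = f := by
  funext ξ
  unfold conv cosetSum
  rw [finsum_eq_single _ (cosetMk Γ ξ)]
  · obtain ⟨γ, hγ, e⟩ := out_mk (Γ := Γ) ξ
    dsimp only
    rw [apply_out hf.left, if_pos, one_mul]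
    rw [e]
    simpa using hγ
  · intro c hc
    dsimp only
    rw [if_neg, zero_mul]
    intro hm
    exact hc (by rw [← cosetMk_eq.2 hm, cosetMk_out])

open Classical in
theorem conv_one (hf : IsHecke Δ Γ f) :
    conv Γ f (fun g => if g ∈ Γ then 1 else 0) = f := by
  funext ξ
  unfold conv cosetSum
  rw [finsum_eq_single _ (cosetMk Γ 1)]
  · obtain ⟨γ, hγ, e⟩ := out_mk (Γ := Γ) (1 : G)
    dsimp only
    rw [e, mul_one, if_pos hγ, mul_one, hf.right _ (Γ.inv_mem hγ)]
  · intro c hc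
    dsimp only
    rw [if_neg, mul_zero]
    intro hm
    refine hc ?_
    rw [← cosetMk_out c, cosetMk_eq]
    simpa using Γ.inv_mem hm

/-! ### From functions to elements of the Hecke ring -/

theorem mk_eq_mk {a b : Δ} :
    HeckeCoset.mk Γ Γ a = HeckeCoset.mk Γ Γ b ↔ ∃ x ∈ Γ, ∃ y ∈ Γ, (b : G) = x * a * y := by
  rw [← DoubleCoset.rel_iff]
  exact Quotient.eq

theorem mem_iff_left [IsHeckeTriple Δ Γ Γ] {γ : G} (hγ : γ ∈ Γ) (g : G) :
    γ * g ∈ Δ ↔ g ∈ Δ := by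
  refine ⟨fun h => ?_, fun h => Δ.mul_mem (IsHeckeTriple.mem_of_mem_left Γ hγ) h⟩
  simpa using Δ.mul_mem (IsHeckeTriple.mem_of_mem_left (Δ := Δ) Γ (Γ.inv_mem hγ)) h

theorem mem_iff_right [IsHeckeTriple Δ Γ Γ] {γ : G} (hγ : γ ∈ Γ) (g : G) :
    g * γ ∈ Δ ↔ g ∈ Δ := by
  refine ⟨fun h => ?_, fun h => Δ.mul_mem h (IsHeckeTriple.mem_of_mem_left Γ hγ)⟩
  simpa using Δ.mul_mem h (IsHeckeTriple.mem_of_mem_left (Δ := Δ) Γ (Γ.inv_mem hγ))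

theorem toFun_mem (F : HeckeRing Δ Γ ℤ) (g : Δ) : toFun F g = F (HeckeCoset.mk Γ Γ g) :=
  dif_pos g.2

theorem toFun_injective : Function.Injective (toFun (Δ := Δ) (Γ := Γ)) := by
  intro F H e
  ext D
  induction D using Quotient.inductionOn with
  | _ g =>
    have := congrFun e g
    rwa [toFun_mem, toFun_mem] at this

/-- A double coset `ΓdΓ` with `d ∈ Δ` is the union of finitely many cosets `Γg`. -/
theorem finite_cosets [IsHeckeTriple Δ Γ Γ] (d : Δ) :
    {c : RightCosets Γ | ∃ x ∈ Γ, ∃ y ∈ Γ, c.out = x * d * y}.Finite := by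
  have hc : (ConjAct.toConjAct (d : G)⁻¹ • Γ).relIndex Γ ≠ 0 :=
    ((Subgroup.Commensurable.commensurator Γ).inv_mem (IsHeckeTriple.mem_commensurator_right Γ d)).1
  set K := (ConjAct.toConjAct (d : G)⁻¹ • Γ).subgroupOf Γ
  have : K.FiniteIndex := ⟨hc⟩
  have : Finite (Quotient (QuotientGroup.rightRel K)) :=
    Finite.of_equiv _ (QuotientGroup.quotientRightRelEquivQuotientLeftRel K).symm
  refine (Set.finite_range
    fun q : Quotient (QuotientGroup.rightRel K) => cosetMk Γ (d * (q.out : Γ))).subset ?_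
  rintro c ⟨x, hx, y, hy, e⟩
  refine ⟨cosetMk K ⟨y, hy⟩, ?_⟩
  obtain ⟨z, hz, e'⟩ := out_mk (Γ := K) ⟨y, hy⟩
  dsimp only
  rw [e', ← cosetMk_out c, e, cosetMk_eq]
  have hz' : (d : G) * z * (d : G)⁻¹ ∈ Γ := by
    have := Subgroup.mem_pointwise_smul_iff_inv_smul_mem.1 (Subgroup.mem_subgroupOf.1 hz)
    simpa [ConjAct.smul_def] using this
  have : x * (d : G) * y * ((d : G) * ((z * ⟨y, hy⟩ : Γ) : G))⁻¹ =
      x * ((d : G) * z * (d : G)⁻¹)⁻¹ := by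
    rw [Subgroup.coe_mul]
    group
  rw [this]
  exact Γ.mul_mem hx (Γ.inv_mem hz')

/-- A representative of a double coset. -/
noncomputable def rep (D : HeckeCoset Δ Γ Γ) : Δ := Quotient.out D

theorem mk_rep (D : HeckeCoset Δ Γ Γ) : HeckeCoset.mk Γ Γ (rep D) = D := Quotient.out_eq D

theorem isHecke_toFun [IsHeckeTriple Δ Γ Γ] (F : HeckeRing Δ Γ ℤ) : IsHecke Δ Γ (toFun F) where
  supp g hg := by
    by_contra h
    exact hg (dif_neg h)
  left γ hγ g := by
    by_cases h : g ∈ Δ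
    · have h' := (mem_iff_left (Δ := Δ) hγ g).2 h
      simp only [toFun, dif_pos h, dif_pos h']
      congr 1
      exact mk_eq_mk.2 ⟨γ⁻¹, Γ.inv_mem hγ, 1, Γ.one_mem, by simp⟩
    · have h' := mt (mem_iff_left (Δ := Δ) hγ g).1 h
      simp only [toFun, dif_neg h, dif_neg h']
  right γ hγ g := by
    by_cases h : g ∈ Δ
    · have h' := (mem_iff_right (Δ := Δ) hγ g).2 h
      simp only [toFun, dif_pos h, dif_pos h']
      congr 1
      exact mk_eq_mk.2 ⟨1, Γ.one_mem, γ⁻¹, Γ.inv_mem hγ, by simp⟩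
    · have h' := mt (mem_iff_right (Δ := Δ) hγ g).1 h
      simp only [toFun, dif_neg h, dif_neg h']
  finite := by
    refine (Set.Finite.biUnion (Finsupp.hasFiniteSupport (HeckeCosetModule.of.symm F))
      (t := fun D => {c : RightCosets Γ | ∃ x ∈ Γ, ∃ y ∈ Γ, c.out = x * rep D * y})
      fun D _ => finite_cosets (rep D)).subset fun c hc => ?_
    simp only [Set.mem_ofPred_eq, toFun] at hc
    split at hc
    case isTrue h =>
      refine Set.mem_biUnion (x := HeckeCoset.mk Γ Γ ⟨c.out, h⟩) hc ?_
      exact mk_eq_mk.1 (mk_rep (HeckeCoset.mk Γ Γ ⟨c.out, h⟩))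
    case isFalse h => exact absurd rfl hc

/-- The element of the Hecke ring given by a bi-invariant function. -/
noncomputable def ofFun (f : G → ℤ) (hf : IsHecke Δ Γ f) : HeckeRing Δ Γ ℤ :=
  HeckeCosetModule.of <| Finsupp.ofSupportFinite
    (fun D : HeckeCoset Δ Γ Γ => f (rep D)) <| by
    refine Set.Finite.of_finite_image (f := fun D => cosetMk Γ (rep D : G)) ?_ ?_
    · refine hf.finite.subset ?_
      rintro _ ⟨D, hD, rfl⟩
      simp only [Set.mem_ofPred_eq]
      rwa [apply_out hf.left]
    · intro D _ E _ h
      dsimp only at h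
      rw [cosetMk_eq] at h
      rw [← mk_rep D, ← mk_rep E]
      exact mk_eq_mk.2 ⟨_, h, 1, Γ.one_mem, by simp⟩

theorem toFun_ofFun (f : G → ℤ) (hf : IsHecke Δ Γ f) : toFun (ofFun f hf) = f := by
  funext g
  by_cases h : g ∈ Δ
  · simp only [toFun, dif_pos h]
    change f (rep (HeckeCoset.mk Γ Γ ⟨g, h⟩)) = f g
    obtain ⟨x, hx, y, hy, e⟩ := mk_eq_mk.1 (mk_rep (HeckeCoset.mk Γ Γ ⟨g, h⟩))
    generalize rep (HeckeCoset.mk Γ Γ ⟨g, h⟩) = a at e ⊢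
    simp only at e
    rw [e, hf.right y hy, hf.left x hx]
  · simp only [toFun, dif_neg h]
    by_contra h'
    exact h (hf.supp g (Ne.symm h'))

theorem toFun_add (F H : HeckeRing Δ Γ ℤ) : toFun (F + H) = toFun F + toFun H := by
  funext g
  by_cases h : g ∈ Δ
  · simp only [toFun, dif_pos h, Pi.add_apply]
    rfl
  · simp [toFun, dif_neg h]

theorem toFun_zero : toFun (0 : HeckeRing Δ Γ ℤ) = 0 := by
  funext g
  by_cases h : g ∈ Δ
  · simp only [toFun, dif_pos h, Pi.zero_apply]
    rfl
  · simp [toFun, dif_neg h]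

theorem conv_add {f h h' : G → ℤ} (hh : IsHecke Δ Γ h) (hh' : IsHecke Δ Γ h') :
    conv Γ f (h + h') = conv Γ f h + conv Γ f h' := by
  funext ξ
  unfold conv cosetSum
  rw [Pi.add_apply, ← finsum_add_distrib]
  · simp [mul_add]
  · exact hh.finite.subset fun c hc => right_ne_zero_of_mul hc
  · exact hh'.finite.subset fun c hc => right_ne_zero_of_mul hc

theorem add_conv {f f' h : G → ℤ} (hh : IsHecke Δ Γ h) :
    conv Γ (f + f') h = conv Γ f h + conv Γ f' h := by
  funext ξ
  rw [Pi.add_apply, conv_eq_sum hh, conv_eq_sum hh, conv_eq_sum hh, ← Finset.sum_add_distrib]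
  simp [add_mul]

end lemmas

/-! ### The ring structure -/

variable (Δ : Submonoid G) (Γ : Subgroup G) [IsHeckeTriple Δ Γ Γ]

/-- The product of the Hecke ring is convolution. For two double cosets, the coefficient of
`ΓξΓ` in `(ΓαΓ)(ΓβΓ)` is the number of cosets `Γb ⊆ ΓβΓ` with `ξb⁻¹ ∈ ΓαΓ`; for decompositions
`ΓαΓ = ⊔ Γαᵢ` and `ΓβΓ = ⊔ Γβⱼ` this is Shimura's multiplicity, the number of pairs `(i, j)` with
`Γαᵢβⱼ = Γξ`. -/
noncomputable instance : Mul (HeckeRing Δ Γ ℤ) where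
  mul F H := ofFun (conv Γ (toFun F) (toFun H)) ((isHecke_toFun F).conv (isHecke_toFun H))

/-- The unit of the Hecke ring is the double coset `Γ1Γ = Γ`. -/
noncomputable instance : One (HeckeRing Δ Γ ℤ) where
  one := HeckeCosetModule.of (Finsupp.single 1 1)

variable {Δ Γ}

theorem toFun_mul (F H : HeckeRing Δ Γ ℤ) : toFun (F * H) = conv Γ (toFun F) (toFun H) :=
  toFun_ofFun _ _

open Classical in
theorem toFun_one : toFun (1 : HeckeRing Δ Γ ℤ) = fun g => if g ∈ Γ then 1 else 0 := by
  funext g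
  have key : ∀ h : g ∈ Δ, (1 : HeckeCoset Δ Γ Γ) = HeckeCoset.mk Γ Γ ⟨g, h⟩ ↔ g ∈ Γ := by
    intro h
    rw [HeckeCoset.one_def, mk_eq_mk]
    constructor
    · rintro ⟨x, hx, y, hy, e⟩
      simp only [mul_one] at e
      exact e ▸ Γ.mul_mem hx hy
    · intro hg
      exact ⟨g, hg, 1, Γ.one_mem, by simp⟩
  by_cases h : g ∈ Δ
  · simp only [toFun, dif_pos h]
    change Finsupp.single (1 : HeckeCoset Δ Γ Γ) (1 : ℤ) _ = _
    rw [Finsupp.single_apply]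
    simp only [key h]
  · simp only [toFun, dif_neg h]
    rw [if_neg fun h' => h (IsHeckeTriple.mem_of_mem_left Γ h')]

noncomputable instance : Ring (HeckeRing Δ Γ ℤ) where
  __ := (inferInstance : AddCommGroup (HeckeRing Δ Γ ℤ))
  mul_assoc F H K := toFun_injective <| by
    simp only [toFun_mul]
    exact conv_assoc (isHecke_toFun F) (isHecke_toFun H) (isHecke_toFun K)
  one_mul F := toFun_injective <| by
    rw [toFun_mul, toFun_one]
    exact one_conv (isHecke_toFun F)
  mul_one F := toFun_injective <| by
    rw [toFun_mul, toFun_one]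
    exact conv_one (isHecke_toFun F)
  left_distrib F H K := toFun_injective <| by
    simp only [toFun_mul, toFun_add]
    exact conv_add (isHecke_toFun H) (isHecke_toFun K)
  right_distrib F H K := toFun_injective <| by
    simp only [toFun_mul, toFun_add]
    exact add_conv (isHecke_toFun K)
  zero_mul F := toFun_injective <| by
    funext ξ
    simp [toFun_mul, toFun_zero, conv, cosetSum]
  mul_zero F := toFun_injective <| by
    funext ξ
    simp [toFun_mul, toFun_zero, conv, cosetSum]

end HeckePair

/-! ## Integral matrices -/

namespace IntegralMatrices

open Matrix
open scoped Pointwise MatrixGroups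

section pair

variable (r : ℕ) (A K : Type*) [CommRing A] [Field K] [Algebra A K]

/-- `GL_r(A)`, as a subgroup of `GL_r(K)`. -/
def integralGL : Subgroup (GL (Fin r) K) := (GeneralLinearGroup.map (algebraMap A K)).range

/-- `M_r(A) ∩ GL_r(K)`, as a submonoid of `GL_r(K)`. -/
def integralMonoid : Submonoid (GL (Fin r) K) :=
  (RingHom.mapMatrix (m := Fin r) (algebraMap A K)).range.toSubmonoid.comap (Units.coeHom _)

variable {r A K}

theorem mem_integralMonoid {g : GL (Fin r) K} :
    g ∈ integralMonoid r A K ↔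
      ∃ M : Matrix (Fin r) (Fin r) A, (algebraMap A K).mapMatrix M = g.val := Iff.rfl

theorem integralGL_le : (integralGL r A K).toSubmonoid ≤ integralMonoid r A K := by
  rintro _ ⟨u, rfl⟩
  exact ⟨u, rfl⟩

/-- For `α` integral there is an integral multiple `n α⁻¹` with `n ≠ 0`. -/
theorem exists_smul_inv {α : GL (Fin r) K} (hα : α ∈ integralMonoid r A K) :
    ∃ n : A, n ≠ 0 ∧ ∃ N : Matrix (Fin r) (Fin r) A,
      (algebraMap A K).mapMatrix N = algebraMap A K n • (α⁻¹).val := by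
  obtain ⟨B, hB⟩ := mem_integralMonoid.1 hα
  have h0 : algebraMap A K B.det = α.val.det := by rw [RingHom.map_det, hB]
  refine ⟨B.det, ?_, B.adjugate, ?_⟩
  · intro h
    rw [h, map_zero] at h0
    exact ((Matrix.isUnit_iff_isUnit_det _).1 α.isUnit).ne_zero h0.symm
  · rw [RingHom.map_adjugate, hB, h0]
    have : α.val.det • (1 : Matrix (Fin r) (Fin r) K) * (α⁻¹).val = α.val.adjugate := by
      rw [← Matrix.adjugate_mul, mul_assoc, ← Units.val_mul, mul_inv_cancel, Units.val_one,
        mul_one]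
    rw [← this, smul_mul_assoc, one_mul]

variable [FaithfulSMul A K]

theorem mapMatrix_injective :
    Function.Injective (RingHom.mapMatrix (m := Fin r) (algebraMap A K)) :=
  Matrix.map_injective (FaithfulSMul.algebraMap_injective A K)

theorem mem_integralGL {g : GL (Fin r) K} :
    g ∈ integralGL r A K ↔ g ∈ integralMonoid r A K ∧ g⁻¹ ∈ integralMonoid r A K := by
  constructor
  · exact fun h => ⟨integralGL_le h, integralGL_le ((integralGL r A K).inv_mem h)⟩
  · rintro ⟨⟨M, hM⟩, ⟨N, hN⟩⟩
    simp only [Units.coeHom_apply] at hM hN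
    refine ⟨⟨M, N, mapMatrix_injective (K := K) ?_, mapMatrix_injective (K := K) ?_⟩,
      Units.ext hM⟩
    · rw [map_mul, map_one, hM, hN, ← Units.val_mul, mul_inv_cancel, Units.val_one]
    · rw [map_mul, map_one, hM, hN, ← Units.val_mul, inv_mul_cancel, Units.val_one]

/-- The principal congruence subgroup of level `n`. -/
def congruence (r : ℕ) (A K : Type*) [CommRing A] [Field K] [Algebra A K] (n : A) :
    Subgroup (GL (Fin r) K) :=
  (GeneralLinearGroup.map (n := Fin r) (Ideal.Quotient.mk (Ideal.span {n}))).ker.map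
    (GeneralLinearGroup.map (algebraMap A K))

theorem congruence_relIndex (n : A) [Finite (A ⧸ Ideal.span {n})] :
    (congruence r A K n).relIndex (integralGL r A K) ≠ 0 := by
  have hinj : Function.Injective (GeneralLinearGroup.map (n := Fin r) (algebraMap A K)) :=
    Units.map_injective mapMatrix_injective
  unfold congruence integralGL
  rw [MonoidHom.range_eq_map, Subgroup.relIndex_map_map_of_injective _ _ hinj,
    Subgroup.relIndex_ker]
  exact Nat.card_pos.ne'

/-- If `s β` and `t β⁻¹` are integral, then conjugation by `β` maps the congruence subgroup of
level `s t` to integral matrices. -/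
theorem conj_mem {β : GL (Fin r) K} {s t : A} {P Q : Matrix (Fin r) (Fin r) A}
    (hP : (algebraMap A K).mapMatrix P = algebraMap A K s • β.val)
    (hQ : (algebraMap A K).mapMatrix Q = algebraMap A K t • (β⁻¹).val)
    {g : GL (Fin r) K} (hg : g ∈ congruence r A K (s * t)) : β * g * β⁻¹ ∈ integralGL r A K := by
  have key : ∀ g ∈ congruence r A K (s * t), β * g * β⁻¹ ∈ integralMonoid r A K := by
    rintro _ ⟨u, hu, rfl⟩
    have : ∀ i j, ∃ x, u.val i j - (1 : Matrix (Fin r) (Fin r) A) i j = s * t * x := by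
      intro i j
      have h1 : (GeneralLinearGroup.map (n := Fin r) (Ideal.Quotient.mk (Ideal.span {s * t}))) u
          = 1 := hu
      have h2 := congrArg (fun v : GL (Fin r) (A ⧸ Ideal.span {s * t}) => v.val i j) h1
      have h3 : Ideal.Quotient.mk (Ideal.span {s * t}) (u.val i j) =
          Ideal.Quotient.mk (Ideal.span {s * t}) ((1 : Matrix (Fin r) (Fin r) A) i j) := by
        refine Eq.trans h2 ?_
        by_cases hij : i = j <;> simp [Matrix.one_apply, hij]
      rw [Ideal.Quotient.eq, Ideal.mem_span_singleton] at h3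
      exact h3
    choose M hM using this
    have hu' : (algebraMap A K).mapMatrix u.val =
        1 + (algebraMap A K s * algebraMap A K t) • (algebraMap A K).mapMatrix (Matrix.of M) := by
      have : u.val = 1 + (s * t) • Matrix.of M := by
        ext i j
        have := hM i j
        rw [sub_eq_iff_eq_add'] at this
        simpa using this
      rw [this, map_add, map_one]
      congr 1
      ext i j
      simp
    refine ⟨1 + P * Matrix.of M * Q, ?_⟩
    rw [map_add, map_one, map_mul, map_mul, hP, hQ]
    change _ = β.val * (algebraMap A K).mapMatrix u.val * (β⁻¹).val
    rw [hu', mul_add, add_mul, mul_one, ← Units.val_mul, mul_inv_cancel, Units.val_one]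
    simp only [smul_mul_assoc, mul_smul_comm, smul_smul, mul_comm]
  refine mem_integralGL.2 ⟨key g hg, ?_⟩
  have := key _ (inv_mem hg)
  simpa [mul_assoc] using this

theorem relIndex_conj_ne_zero [Ring.HasFiniteQuotients A] {β : GL (Fin r) K} {s t : A}
    (hst : s * t ≠ 0) {P Q : Matrix (Fin r) (Fin r) A}
    (hP : (algebraMap A K).mapMatrix P = algebraMap A K s • β.val)
    (hQ : (algebraMap A K).mapMatrix Q = algebraMap A K t • (β⁻¹).val) :
    (ConjAct.toConjAct β⁻¹ • integralGL r A K).relIndex (integralGL r A K) ≠ 0 := by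
  have : Finite (A ⧸ Ideal.span {s * t}) :=
    Ring.HasFiniteQuotients.finiteQuotient (by simpa using hst)
  refine fun h => congruence_relIndex (r := r) (K := K) (s * t)
    (Subgroup.relIndex_eq_zero_of_le_left ?_ h)
  intro g hg
  rw [Subgroup.mem_pointwise_smul_iff_inv_smul_mem]
  simpa [ConjAct.smul_def] using conj_mem hP hQ hg

/-- `(GL_r(A), M_r(A) ∩ GL_r(K))` is a Hecke pair if all proper quotients of `A` are finite. -/
instance isHeckeTriple [Ring.HasFiniteQuotients A] :
    IsHeckeTriple (integralMonoid r A K) (integralGL r A K) (integralGL r A K) := by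
  refine .of_diagonal integralGL_le fun α hα => ?_
  obtain ⟨n, hn, N, hN⟩ := exists_smul_inv hα
  obtain ⟨B, hB⟩ := mem_integralMonoid.1 hα
  change Subgroup.Commensurable (ConjAct.toConjAct α • integralGL r A K) (integralGL r A K)
  constructor
  · have := relIndex_conj_ne_zero (β := α⁻¹) (s := n) (t := 1) (by simpa using hn) hN
      (by simpa using hB)
    simpa using this
  · rw [← Subgroup.relIndex_pointwise_smul (ConjAct.toConjAct α⁻¹), smul_smul, ← map_mul,
      inv_mul_cancel, map_one, one_smul]
    exact relIndex_conj_ne_zero (s := 1) (t := n) (by simpa using hn) (by simpa using hB) hN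

end pair

/-! ## Restricted products of Hecke pairs -/

section restricted

open Filter RestrictedProduct

variable {ι : Type*} {G : ι → Type*} [∀ i, Group (G i)] (Γ : ∀ i, Subgroup (G i))
  (Δ : ∀ i, Submonoid (G i))

/-- `∏ Γ_i`, inside the restricted product of the groups `G_i` with respect to `Γ_i`. -/
def prodSubgroup : Subgroup (Πʳ i, [G i, Γ i]) :=
  ⨅ i, (Γ i).comap (RestrictedProduct.evalMonoidHom G i)

/-- The restricted product of the monoids `Δ_i` with respect to `Γ_i`. -/
def prodSubmonoid : Submonoid (Πʳ i, [G i, Γ i]) :=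
  ⨅ i, (Δ i).comap (RestrictedProduct.evalMonoidHom G i)

variable {Γ Δ}

theorem mem_prodSubgroup {x : Πʳ i, [G i, Γ i]} : x ∈ prodSubgroup Γ ↔ ∀ i, x i ∈ Γ i := by
  simp [prodSubgroup, Subgroup.mem_iInf]

theorem mem_prodSubmonoid {x : Πʳ i, [G i, Γ i]} : x ∈ prodSubmonoid Γ Δ ↔ ∀ i, x i ∈ Δ i := by
  simp [prodSubmonoid, Submonoid.mem_iInf]

theorem prod_relIndex {a : Πʳ i, [G i, Γ i]}
    (h : ∀ i, (ConjAct.toConjAct (a i) • Γ i).relIndex (Γ i) ≠ 0) :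
    (ConjAct.toConjAct a • prodSubgroup Γ).relIndex (prodSubgroup Γ) ≠ 0 := by
  have hfin : {i | a i ∉ Γ i}.Finite := a.2
  have : Finite {i | a i ∉ Γ i} := hfin
  have h1 : (⨅ i : {i | a i ∉ Γ i}, (ConjAct.toConjAct (a i) • Γ i).comap
      (RestrictedProduct.evalMonoidHom (B := Γ) (𝓕 := cofinite) G i)).relIndex
        (prodSubgroup Γ) ≠ 0 := by
    refine Subgroup.relIndex_iInf_ne_zero fun i h0 => ?_
    rw [Subgroup.relIndex_comap] at h0
    refine h i (Subgroup.relIndex_eq_zero_of_le_right ?_ h0)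
    rintro _ ⟨x, hx, rfl⟩
    exact mem_prodSubgroup.1 hx i
  intro h0
  refine h1 ?_
  rw [← Subgroup.inf_relIndex_right]
  refine Subgroup.relIndex_eq_zero_of_le_left ?_ h0
  rintro x ⟨hx, hx'⟩
  rw [Subgroup.mem_pointwise_smul_iff_inv_smul_mem]
  refine mem_prodSubgroup.2 fun i => ?_
  have e : ((ConjAct.toConjAct a)⁻¹ • x) i = (ConjAct.toConjAct (a i))⁻¹ • x i := by
    rw [← ConjAct.toConjAct_inv, ← ConjAct.toConjAct_inv, ConjAct.toConjAct_smul,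
      ConjAct.toConjAct_smul]
    rfl
  rw [e]
  by_cases hi : a i ∈ Γ i
  · have := mem_prodSubgroup.1 hx' i
    rw [← ConjAct.toConjAct_inv, ConjAct.toConjAct_smul]
    exact mul_mem (mul_mem (inv_mem hi) this) (inv_mem (inv_mem hi))
  · have := Subgroup.mem_iInf.1 hx ⟨i, hi⟩
    exact Subgroup.mem_pointwise_smul_iff_inv_smul_mem.1 this

theorem prod_isHeckeTriple [∀ i, IsHeckeTriple (Δ i) (Γ i) (Γ i)] :
    IsHeckeTriple (prodSubmonoid Γ Δ) (prodSubgroup Γ) (prodSubgroup Γ) := by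
  refine .of_diagonal ?_ fun a ha => ?_
  · exact fun x hx => mem_prodSubmonoid.2 fun i =>
      IsHeckeTriple.mem_of_mem_left (Γ i) (mem_prodSubgroup.1 hx i)
  · have hc : ∀ i, a i ∈ Subgroup.Commensurable.commensurator (Γ i) := fun i =>
      IsHeckeTriple.mem_commensurator_right (Γ i) (⟨a i, mem_prodSubmonoid.1 ha i⟩ : Δ i)
    change Subgroup.Commensurable (ConjAct.toConjAct a • prodSubgroup Γ) (prodSubgroup Γ)
    constructor
    · exact prod_relIndex fun i => (hc i).1
    · rw [← Subgroup.relIndex_pointwise_smul (ConjAct.toConjAct a⁻¹), smul_smul, ← map_mul,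
        inv_mul_cancel, map_one, one_smul]
      exact prod_relIndex fun i => (inv_mem (hc i)).1

end restricted

end IntegralMatrices

/-! ## The Hecke rings of `ℤ^r` and the map `η^*` -/

namespace HeckeZr

open Matrix IntegralMatrices Filter RestrictedProduct
open scoped MatrixGroups

instance (p : Nat.Primes) : Fact (p : ℕ).Prime := ⟨p.2⟩

instance (p : ℕ) [Fact p.Prime] : Ring.HasFiniteQuotients ℤ_[p] where
  finiteQuotient {I} hI := by
    obtain ⟨n, rfl⟩ := PadicInt.ideal_eq_span_pow_p hI
    have : NeZero (p ^ n) := ⟨pow_ne_zero _ (Fact.out : p.Prime).ne_zero⟩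
    rw [← PadicInt.ker_toZModPow]
    exact Finite.of_injective _ (RingHom.kerLift_injective (PadicInt.toZModPow n))

variable (r : ℕ)

/-- `Γ = GL_r(ℤ)`. -/
abbrev Gam : Subgroup (GL (Fin r) ℚ) := integralGL r ℤ ℚ

/-- `Δ = M_r(ℤ) ∩ GL_r(ℚ)`. -/
abbrev Del : Submonoid (GL (Fin r) ℚ) := integralMonoid r ℤ ℚ

/-- `Γ_p = GL_r(ℤ_p)`. -/
noncomputable abbrev GamP (p : Nat.Primes) : Subgroup (GL (Fin r) ℚ_[p]) := integralGL r ℤ_[p] ℚ_[p]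

/-- `Δ_p = M_r(ℤ_p) ∩ GL_r(ℚ_p)`. -/
noncomputable abbrev DelP (p : Nat.Primes) : Submonoid (GL (Fin r) ℚ_[p]) := integralMonoid r ℤ_[p] ℚ_[p]

/-- The restricted product of the groups `GL_r(ℚ_p)` with respect to `GL_r(ℤ_p)`. -/
abbrev GHat : Type := Πʳ p : Nat.Primes, [GL (Fin r) ℚ_[p], GamP r p]

/-- `Γ̂ = ∏_p GL_r(ℤ_p)`. -/
noncomputable abbrev GamHat : Subgroup (GHat r) := prodSubgroup (GamP r)

/-- `Δ̂`, the restricted product of the monoids `Δ_p` with respect to `Γ_p`. -/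
noncomputable abbrev DelHat : Submonoid (GHat r) := prodSubmonoid (GamP r) (DelP r)

instance : IsHeckeTriple (DelHat r) (GamHat r) (GamHat r) := prod_isHeckeTriple

/-- The Hecke ring of `(Γ, Δ)`. -/
abbrev R : Type := HeckeRing (Del r) (Gam r) ℤ

/-- The Hecke ring of `(Γ̂, Δ̂)`. -/
abbrev RHat : Type := HeckeRing (DelHat r) (GamHat r) ℤ

variable {r}

theorem mem_DelP {p : Nat.Primes} {g : GL (Fin r) ℚ_[p]} :
    g ∈ DelP r p ↔ ∀ i j, ‖g.val i j‖ ≤ 1 := by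
  rw [mem_integralMonoid]
  constructor
  · rintro ⟨M, hM⟩ i j
    rw [← hM]
    exact (M i j).2
  · intro h
    exact ⟨Matrix.of fun i j => ⟨g.val i j, h i j⟩, by ext; rfl⟩

theorem map_mem_DelP {g : GL (Fin r) ℚ} (hg : g ∈ Del r) (p : Nat.Primes) :
    GeneralLinearGroup.map (algebraMap ℚ ℚ_[p]) g ∈ DelP r p := by
  obtain ⟨M, hM⟩ := mem_integralMonoid.1 hg
  refine mem_DelP.2 fun i j => ?_
  rw [GeneralLinearGroup.map_apply, ← hM]
  simpa using Padic.norm_int_le_one (p := p) (M i j)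

/-- A rational number is `p`-integral for almost all `p`. -/
theorem eventually_norm_le (q : ℚ) :
    ∀ᶠ p : Nat.Primes in cofinite, ‖algebraMap ℚ ℚ_[p] q‖ ≤ 1 := by
  have : {p : Nat.Primes | (p : ℕ) ∣ q.den}.Finite := by
    refine Set.Finite.of_finite_image (f := ((↑) : Nat.Primes → ℕ)) ?_
      (Nat.Primes.coe_nat_injective.injOn)
    refine (Finset.finite_toSet q.den.divisors).subset ?_
    rintro _ ⟨p, hp, rfl⟩
    simp only [Finset.mem_coe, Nat.mem_divisors]
    exact ⟨hp, q.den_ne_zero⟩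
  filter_upwards [this.compl_mem_cofinite] with p hp
  simpa using Padic.norm_rat_le_one hp

theorem eventually_mem_DelP (g : GL (Fin r) ℚ) :
    ∀ᶠ p : Nat.Primes in cofinite,
      GeneralLinearGroup.map (algebraMap ℚ ℚ_[p]) g ∈ DelP r p := by
  have : ∀ᶠ p : Nat.Primes in cofinite, ∀ i j, ‖algebraMap ℚ ℚ_[p] (g.val i j)‖ ≤ 1 :=
    eventually_all.2 fun i => eventually_all.2 fun j => eventually_norm_le _
  filter_upwards [this] with p hp
  exact mem_DelP.2 fun i j => by simpa [GeneralLinearGroup.map_apply] using hp i j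

variable (r) in
/-- The diagonal embedding `η` of `GL_r(ℚ)` into the restricted product. -/
noncomputable def eta : GL (Fin r) ℚ →* GHat r where
  toFun g := ⟨fun p => GeneralLinearGroup.map (algebraMap ℚ ℚ_[p]) g, by
    filter_upwards [eventually_mem_DelP g, eventually_mem_DelP g⁻¹] with p h h'
    exact mem_integralGL.2 ⟨h, by rwa [← map_inv]⟩⟩
  map_one' := by
    ext1 p
    exact map_one (GeneralLinearGroup.map (algebraMap ℚ ℚ_[p]))
  map_mul' g h := by
    ext1 p
    exact map_mul (GeneralLinearGroup.map (algebraMap ℚ ℚ_[p])) g h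

theorem eta_apply (g : GL (Fin r) ℚ) (p : Nat.Primes) :
    eta r g p = GeneralLinearGroup.map (algebraMap ℚ ℚ_[p]) g := rfl

theorem eta_mem_DelHat {g : GL (Fin r) ℚ} (hg : g ∈ Del r) : eta r g ∈ DelHat r :=
  mem_prodSubmonoid.2 fun p => map_mem_DelP hg p

theorem eta_mem_GamHat {g : GL (Fin r) ℚ} (hg : g ∈ Gam r) : eta r g ∈ GamHat r :=
  mem_prodSubgroup.2 fun p => mem_integralGL.2
    ⟨map_mem_DelP (mem_integralGL.1 hg).1 p, by
      rw [eta_apply, ← map_inv]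
      exact map_mem_DelP (mem_integralGL.1 hg).2 p⟩

variable (r) in
/-- The map `Γ\Δ/Γ → Γ̂\Δ̂/Γ̂`, `ΓαΓ ↦ Γ̂η(α)Γ̂`. -/
noncomputable def etaCoset : HeckeCoset (Del r) (Gam r) (Gam r) →
    HeckeCoset (DelHat r) (GamHat r) (GamHat r) :=
  Quotient.map (fun a : Del r => (⟨eta r a, eta_mem_DelHat a.2⟩ : DelHat r)) fun a b h => by
    obtain ⟨x, hx, y, hy, e⟩ := DoubleCoset.rel_iff.1 h
    refine DoubleCoset.rel_iff.2 ⟨eta r x, eta_mem_GamHat hx, eta r y, eta_mem_GamHat hy, ?_⟩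
    simp only [e, map_mul]

/-- A rational number that is `p`-integral for all `p` is an integer. -/
theorem exists_int_of_forall {q : ℚ} (h : ∀ p : Nat.Primes, ‖algebraMap ℚ ℚ_[p] q‖ ≤ 1) :
    ∃ z : ℤ, (z : ℚ) = q := by
  have hden : q.den = 1 := by
    by_contra hne
    obtain ⟨p, hp, hd⟩ := Nat.exists_prime_and_dvd hne
    have : Fact p.Prime := ⟨hp⟩
    have h1 := PadicInt.isUnit_den (p := p) q (by simpa using h ⟨p, hp⟩)
    rw [PadicInt.isUnit_iff] at h1
    exact absurd h1 (PadicInt.norm_natCast_lt_one_iff.2 hd).ne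
  exact ⟨q.num, by simpa using Rat.coe_int_num_of_den_eq_one hden⟩

theorem exists_smul_inv_of_eq {a b : GL (Fin r) ℚ} {x y : GHat r} (hx : x ∈ GamHat r)
    (hy : y ∈ GamHat r) (e : eta r a = x * eta r b * y) {n : ℤ} {N : Matrix (Fin r) (Fin r) ℤ}
    (hN : (algebraMap ℤ ℚ).mapMatrix N = algebraMap ℤ ℚ n • (b⁻¹).val) :
    ∃ N' : Matrix (Fin r) (Fin r) ℤ,
      (algebraMap ℤ ℚ).mapMatrix N' = algebraMap ℤ ℚ n • (a⁻¹).val := by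
  have key : ∀ i j, ∃ z : ℤ, (z : ℚ) = (algebraMap ℤ ℚ n • (a⁻¹).val) i j := by
    refine fun i j => exists_int_of_forall fun p => ?_
    obtain ⟨X, hX⟩ := mem_integralMonoid.1 (mem_integralGL.1 (mem_prodSubgroup.1 hx p)).2
    obtain ⟨Y, hY⟩ := mem_integralMonoid.1 (mem_integralGL.1 (mem_prodSubgroup.1 hy p)).2
    have e1 : eta r a⁻¹ p = (y p)⁻¹ * eta r b⁻¹ p * (x p)⁻¹ := by
      have : eta r a⁻¹ = y⁻¹ * eta r b⁻¹ * x⁻¹ := by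
        rw [map_inv, e, map_inv]
        group
      rw [this]
      rfl
    have e2 : (algebraMap ℚ ℚ_[p]).mapMatrix (a⁻¹).val =
        ((y p)⁻¹).val * (algebraMap ℚ ℚ_[p]).mapMatrix (b⁻¹).val * ((x p)⁻¹).val :=
      congrArg Units.val e1
    have sm : ∀ M : Matrix (Fin r) (Fin r) ℚ, (algebraMap ℚ ℚ_[p]).mapMatrix
        (algebraMap ℤ ℚ n • M) = (n : ℚ_[p]) • (algebraMap ℚ ℚ_[p]).mapMatrix M := by
      intro M
      ext i j
      simp
    have e3 : (algebraMap ℚ ℚ_[p]).mapMatrix (algebraMap ℤ ℚ n • (a⁻¹).val) =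
        (algebraMap ℤ_[p] ℚ_[p]).mapMatrix (Y * (Int.castRingHom ℤ_[p]).mapMatrix N * X) := by
      have h1 : (algebraMap ℚ ℚ_[p]).mapMatrix ((algebraMap ℤ ℚ).mapMatrix N) =
          (algebraMap ℤ_[p] ℚ_[p]).mapMatrix ((Int.castRingHom ℤ_[p]).mapMatrix N) := by
        ext i j
        simp
      rw [map_mul, map_mul, hX, hY, ← h1, hN, sm, sm, e2]
      simp
    have e4 := congrFun (congrFun e3 i) j
    refine le_of_eq_of_le (congrArg norm e4) ?_
    exact ((Y * (Int.castRingHom ℤ_[p]).mapMatrix N * X) i j).2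
  choose N' hN' using key
  exact ⟨Matrix.of N', by ext i j; exact hN' i j⟩

theorem inv_mul_mem {a b : GL (Fin r) ℚ} {A B M N : Matrix (Fin r) (Fin r) ℤ} {n : ℤ}
    (hA : (algebraMap ℤ ℚ).mapMatrix A = a.val) (hB : (algebraMap ℤ ℚ).mapMatrix B = b.val)
    (hN : (algebraMap ℤ ℚ).mapMatrix N = algebraMap ℤ ℚ n • (a⁻¹).val) (h : B = A + n • M) :
    a⁻¹ * b ∈ Del r := by
  refine mem_integralMonoid.2 ⟨1 + N * M, ?_⟩
  have e : b.val = a.val + algebraMap ℤ ℚ n • (algebraMap ℤ ℚ).mapMatrix M := by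
    rw [← hB, ← hA, h, map_add]
    congr 1
    ext i j
    exact Int.cast_mul n (M i j)
  rw [Units.val_mul, e, mul_add, ← Units.val_mul, inv_mul_cancel, map_add, map_one, map_mul, hN]
  simp

/-- Only finitely many double cosets `ΓαΓ` lie over a given double coset of `Γ̂`. -/
theorem finite_fiber (D : HeckeCoset (DelHat r) (GamHat r) (GamHat r)) :
    (etaCoset r ⁻¹' {D}).Finite := by
  rcases (etaCoset r ⁻¹' {D}).eq_empty_or_nonempty with h | ⟨D₀, hD₀⟩
  · rw [h]
    exact Set.finite_empty
  obtain ⟨n, hn, N₀, hN₀⟩ := exists_smul_inv (HeckePair.rep D₀).2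
  have hinv : ∀ E ∈ etaCoset r ⁻¹' {D}, ∃ N : Matrix (Fin r) (Fin r) ℤ,
      (algebraMap ℤ ℚ).mapMatrix N =
        algebraMap ℤ ℚ n • ((HeckePair.rep E : GL (Fin r) ℚ)⁻¹).val := by
    intro E hE
    have h : etaCoset r (HeckeCoset.mk _ _ (HeckePair.rep D₀)) =
        etaCoset r (HeckeCoset.mk _ _ (HeckePair.rep E)) := by
      rw [HeckePair.mk_rep, HeckePair.mk_rep]
      exact hD₀.trans hE.symm
    obtain ⟨x, hx, y, hy, e⟩ := HeckePair.mk_eq_mk.1 h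
    exact exists_smul_inv_of_eq hx hy e hN₀
  choose B hB using fun E : HeckeCoset (Del r) (Gam r) (Gam r) =>
    mem_integralMonoid.1 (HeckePair.rep E).2
  have : Finite (ℤ ⧸ Ideal.span {n}) :=
    Ring.HasFiniteQuotients.finiteQuotient (by simpa using hn)
  refine Set.Finite.of_finite_image
    (f := fun E => (Ideal.Quotient.mk (Ideal.span {n})).mapMatrix (B E)) (Set.toFinite _) ?_
  have aux : ∀ E F : HeckeCoset (Del r) (Gam r) (Gam r),
      (Ideal.Quotient.mk (Ideal.span {n})).mapMatrix (B E) =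
        (Ideal.Quotient.mk (Ideal.span {n})).mapMatrix (B F) → ∃ M, B F = B E + n • M := by
    intro E F h
    have : ∀ i j, ∃ m, B F i j - B E i j = n * m := by
      intro i j
      have h1 := congrFun (congrFun h.symm i) j
      exact Ideal.mem_span_singleton.1 (Ideal.Quotient.eq.1 h1)
    choose M hM using this
    refine ⟨Matrix.of M, ?_⟩
    ext i j
    have := hM i j
    simp
    linarith
  intro E hE F hF h
  obtain ⟨M, hM⟩ := aux E F h
  obtain ⟨M', hM'⟩ := aux F E h.symm
  obtain ⟨N, hN⟩ := hinv E hE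
  obtain ⟨N', hN'⟩ := hinv F hF
  have h1 := inv_mul_mem (hB E) (hB F) hN hM
  have h2 := inv_mul_mem (hB F) (hB E) hN' hM'
  rw [← HeckePair.mk_rep E, ← HeckePair.mk_rep F, HeckePair.mk_eq_mk]
  refine ⟨1, one_mem _, _, mem_integralGL.2 ⟨h1, ?_⟩, by simp⟩
  simpa using h2

variable (r) in
/-- The additive map `η^* : R̂ → R`. Viewing elements of the Hecke rings as functions on double
cosets, it is the pullback along `ΓαΓ ↦ Γ̂η(α)Γ̂`; on the basis, it maps `Γ̂α̂Γ̂` to the sum of the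
finitely many `ΓαΓ` contained in `η⁻¹(Γ̂α̂Γ̂)`. -/
noncomputable def etaStar : RHat r →+ R r where
  toFun F := HeckeCosetModule.of <| Finsupp.ofSupportFinite (fun D => F (etaCoset r D)) <|
    (Set.Finite.preimage' (Finsupp.hasFiniteSupport (HeckeCosetModule.of.symm F))
      fun D _ => finite_fiber D : (etaCoset r ⁻¹' _).Finite)
  map_zero' := by
    ext D
    rfl
  map_add' F H := by
    ext D
    rfl

end HeckeZr

/-! Since `etaStar` is pullback of functions along `etaCoset`, the theorem reduces to two facts
about `η`: it induces bijections on double cosets and on the one-sided cosets inside `Δ` and `Δ̂`.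

One-sided cosets give multiplicativity. The preimage of `Γ̂` under `η` is `Γ` (a rational that is
`p`-integral for every `p` is an integer), so `Γg ↦ Γ̂η(g)` is injective. Every `α ∈ Δ̂` lies in
`Γ̂η(g)` for some `g ∈ Δ`: the local row lattices of the `α_p` come from a single lattice in `ℤ^r`,
which is free (`exists_mul_eta_inv_mem`). Hence the convolution sums at `η(ξ)` over `Γ̂\Δ̂` and at
`ξ` over `Γ\Δ` agree term by term (`cosetSum_eta`).

Double cosets give bijectivity. Surjectivity of `etaCoset` is again the lattice argument.
Injectivity says that integer matrices equivalent over every `ℤ_p` are equivalent over `ℤ`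
(`areEquivalent_of_forall_padicInt`). This goes by induction on the size: reduction over `ℤ` splits
off the gcd `a` of the entries, leaving `a • (1 ⊕ A')`. The local hypotheses determine `a` up to
sign, and the block `1` can be cancelled because `ℤ_p` is local. -/

namespace Matrix

/-! ### Equivalence of square matrices, and cancellation over local rings. -/

section AreEquivalent

variable {n m R S : Type*} [Fintype n] [DecidableEq n] [Fintype m] [DecidableEq m]
  [CommRing R] [CommRing S]

theorem _root_.RingHom.mapMatrix_smul (f : R →+* S) (a : R) (A : Matrix n n R) :
    f.mapMatrix (a • A) = f a • f.mapMatrix A := by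
  ext i j
  simp

/-- Two square matrices are equivalent if they differ by invertible factors on both sides. -/
def AreEquivalent (A B : Matrix n n R) : Prop :=
  ∃ P Q : Matrix n n R, IsUnit P.det ∧ IsUnit Q.det ∧ B = P * A * Q

namespace AreEquivalent

variable {A B C : Matrix n n R}

theorem refl (A : Matrix n n R) : AreEquivalent A A := ⟨1, 1, by simp, by simp, by simp⟩

theorem symm (h : AreEquivalent A B) : AreEquivalent B A := by
  obtain ⟨P, Q, hP, hQ, rfl⟩ := h
  refine ⟨P⁻¹, Q⁻¹, isUnit_nonsing_inv_det P hP, isUnit_nonsing_inv_det Q hQ, ?_⟩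
  rw [Matrix.mul_assoc, Matrix.mul_assoc, Matrix.mul_assoc, Matrix.mul_nonsing_inv _ hQ,
    Matrix.mul_one, ← Matrix.mul_assoc, Matrix.nonsing_inv_mul _ hP, Matrix.one_mul]

theorem trans (h : AreEquivalent A B) (h' : AreEquivalent B C) : AreEquivalent A C := by
  obtain ⟨P, Q, hP, hQ, rfl⟩ := h
  obtain ⟨P', Q', hP', hQ', rfl⟩ := h'
  refine ⟨P' * P, Q * Q', ?_, ?_, by simp only [Matrix.mul_assoc]⟩
  · rw [det_mul]
    exact hP'.mul hP
  · rw [det_mul]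
    exact hQ.mul hQ'

theorem map (h : AreEquivalent A B) (f : R →+* S) :
    AreEquivalent (f.mapMatrix A) (f.mapMatrix B) := by
  obtain ⟨P, Q, hP, hQ, rfl⟩ := h
  refine ⟨f.mapMatrix P, f.mapMatrix Q, ?_, ?_, by simp only [map_mul]⟩
  · rw [← RingHom.map_det]
    exact hP.map f
  · rw [← RingHom.map_det]
    exact hQ.map f

theorem submatrix (h : AreEquivalent A B) (e : m ≃ n) :
    AreEquivalent (A.submatrix e e) (B.submatrix e e) := by
  obtain ⟨P, Q, hP, hQ, rfl⟩ := h
  refine ⟨P.submatrix e e, Q.submatrix e e, ?_, ?_, ?_⟩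
  · rwa [det_submatrix_equiv_self]
  · rwa [det_submatrix_equiv_self]
  · simp only [submatrix_mul_equiv]

theorem smul (h : AreEquivalent A B) (a : R) : AreEquivalent (a • A) (a • B) := by
  obtain ⟨P, Q, hP, hQ, rfl⟩ := h
  exact ⟨P, Q, hP, hQ, by simp⟩

theorem smul_unit (A : Matrix n n R) (u : Rˣ) : AreEquivalent A ((u : R) • A) :=
  ⟨(u : R) • 1, 1, by simpa [det_smul] using u.isUnit.pow _, by simp, by simp⟩

theorem of_smul [IsDomain R] {a : R} (ha : a ≠ 0) (h : AreEquivalent (a • A) (a • B)) :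
    AreEquivalent A B := by
  obtain ⟨P, Q, hP, hQ, h⟩ := h
  refine ⟨P, Q, hP, hQ, smul_right_injective _ ha ?_⟩
  simpa using h

theorem dvd (h : AreEquivalent A B) {a : R} (ha : ∀ i j, a ∣ A i j) (i j : n) : a ∣ B i j := by
  obtain ⟨P, Q, -, -, rfl⟩ := h
  simp only [mul_apply, Finset.sum_mul]
  exact Finset.dvd_sum fun k _ => Finset.dvd_sum fun l _ =>
    Dvd.dvd.mul_right (Dvd.dvd.mul_left (ha l k) _) _

theorem transvection_mul (A : Matrix n n R) {i j : n} (h : i ≠ j) (c : R) :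
    AreEquivalent A (transvection i j c * A) :=
  ⟨transvection i j c, 1, by simp [det_transvection_of_ne _ _ h], by simp, by simp⟩

theorem mul_transvection (A : Matrix n n R) {i j : n} (h : i ≠ j) (c : R) :
    AreEquivalent A (A * transvection i j c) :=
  ⟨1, transvection i j c, by simp, by simp [det_transvection_of_ne _ _ h], by simp⟩

theorem submatrix_perm (A : Matrix n n R) (σ τ : Equiv.Perm n) :
    AreEquivalent A (A.submatrix σ τ) := by
  refine ⟨(1 : Matrix n n R).submatrix σ id, (1 : Matrix n n R).submatrix id τ, ?_, ?_, ?_⟩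
  · rw [det_permute, det_one, mul_one]
    exact (Equiv.Perm.sign σ).isUnit.map (Int.castRingHom R)
  · rw [det_permute', det_one, mul_one]
    exact (Equiv.Perm.sign τ).isUnit.map (Int.castRingHom R)
  · ext i j
    simp [mul_apply, one_apply]

/-- The pivot block `1` clears its row and column, leaving the Schur complement. -/
theorem fromBlocks_one (u : Matrix Unit n R) (v : Matrix n Unit R) (D : Matrix n n R) :
    AreEquivalent (fromBlocks 1 u v D) (fromBlocks 1 0 0 (D - v * u)) := by
  refine ⟨fromBlocks 1 0 (-v) 1, fromBlocks 1 (-u) 0 1, by simp, by simp, ?_⟩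
  simp [fromBlocks_multiply, sub_eq_neg_add]

/-- Comparing blocks gives `x₁₁ = y₁₁`, `x₁₂A = y₁₂`, `x₂₁ = By₂₁` and `x₂₂A = By₂₂`. The Schur
complements `S`, `T` of this common corner in the two outer factors therefore satisfy `SA = BT`.
Both are invertible, since the determinant of a block matrix is that of the corner times that of the
Schur complement. -/
theorem of_fromBlocks_mul_eq {A B : Matrix n n R} {x₁₁ y₁₁ : Matrix Unit Unit R}
    {x₁₂ y₁₂ : Matrix Unit n R} {x₂₁ y₂₁ : Matrix n Unit R} {x₂₂ y₂₂ : Matrix n n R}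
    (hX : IsUnit (fromBlocks x₁₁ x₁₂ x₂₁ x₂₂).det) (hY : IsUnit (fromBlocks y₁₁ y₁₂ y₂₁ y₂₂).det)
    (h₁₁ : IsUnit x₁₁.det)
    (h : fromBlocks x₁₁ x₁₂ x₂₁ x₂₂ * fromBlocks 1 0 0 A =
      fromBlocks 1 0 0 B * fromBlocks y₁₁ y₁₂ y₂₁ y₂₂) : AreEquivalent A B := by
  simp only [fromBlocks_multiply, Matrix.mul_one, Matrix.mul_zero, Matrix.zero_mul, Matrix.one_mul,
    add_zero, zero_add, fromBlocks_inj] at h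
  obtain ⟨rfl, rfl, rfl, h⟩ := h
  have := invertibleOfIsUnitDet _ h₁₁
  rw [det_fromBlocks₁₁] at hX hY
  have hX' := isUnit_of_mul_isUnit_right hX
  have hY' := isUnit_of_mul_isUnit_right hY
  have key : (x₂₂ - B * y₂₁ * ⅟x₁₁ * x₁₂) * A = B * (y₂₂ - y₂₁ * ⅟x₁₁ * (x₁₂ * A)) := by
    simp only [Matrix.sub_mul, Matrix.mul_sub, h, Matrix.mul_assoc]
  refine ⟨_, _, hX', isUnit_nonsing_inv_det _ hY', ?_⟩
  rw [key, Matrix.mul_assoc, Matrix.mul_nonsing_inv _ hY', Matrix.mul_one]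

/-- Cancellation of a unit block over a local ring. -/
theorem of_fromBlocks_one [IsLocalRing R] {A B : Matrix n n R}
    (h : AreEquivalent (fromBlocks (1 : Matrix Unit Unit R) 0 0 A) (fromBlocks 1 0 0 B)) :
    AreEquivalent A B := by
  obtain ⟨X, Q, hX, hQ, h⟩ := h
  have hY := isUnit_nonsing_inv_det Q hQ
  have h1 : X * fromBlocks 1 0 0 A = fromBlocks 1 0 0 B * Q⁻¹ := by
    rw [h, Matrix.mul_assoc, Matrix.mul_nonsing_inv _ hQ, Matrix.mul_one]
  have hinv := Matrix.nonsing_inv_mul _ hX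
  generalize Q⁻¹ = Y at h1 hY
  generalize X⁻¹ = Z at hinv
  rw [← fromBlocks_toBlocks X] at hX h1 hinv
  rw [← fromBlocks_toBlocks Y] at hY h1
  rw [← fromBlocks_toBlocks Z] at hinv
  generalize X.toBlocks₁₁ = x₁₁, X.toBlocks₁₂ = x₁₂, X.toBlocks₂₁ = x₂₁, X.toBlocks₂₂ = x₂₂ at *
  generalize Y.toBlocks₁₁ = y₁₁, Y.toBlocks₁₂ = y₁₂, Y.toBlocks₂₁ = y₂₁, Y.toBlocks₂₂ = y₂₂ at *
  generalize Z.toBlocks₁₁ = z₁₁, Z.toBlocks₁₂ = z₁₂, Z.toBlocks₂₁ = z₂₁, Z.toBlocks₂₂ = z₂₂ at *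
  by_cases hu : IsUnit x₁₁.det
  · exact of_fromBlocks_mul_eq hX hY hu h1
  -- The corner of `ZX = 1` reads `z₁₁x₁₁ + z₁₂x₂₁ = 1`. If `x₁₁` is a nonunit, locality makes
  -- `z₁₂x₂₁` a unit, and then also its sum with `x₁₁`. So adding `z₁₂` times the lower block row of
  -- `X` to the upper one produces an invertible corner.
  have hw : IsUnit (x₁₁ + z₁₂ * x₂₁).det := by
    rw [fromBlocks_multiply, ← Matrix.fromBlocks_one, fromBlocks_inj] at hinv
    have h2 := congrFun (congrFun hinv.1 ()) ()
    simp only [add_apply, one_apply_eq] at h2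
    simp only [det_unique, PUnit.default_eq_unit, add_apply] at hu ⊢
    have hz : IsUnit ((z₁₂ * x₂₁) () ()) := by
      by_contra hz
      have hz' : z₁₁ () () * x₁₁ () () ∈ nonunits R := fun hz' => hu (isUnit_of_mul_isUnit_right hz')
      refine IsLocalRing.nonunits_add hz' hz ?_
      rw [show z₁₁ () () * x₁₁ () () = (z₁₁ * x₁₁) () () by simp [mul_apply], h2]
      exact isUnit_one
    by_contra hs
    have := IsLocalRing.nonunits_add hs (show -(x₁₁ () ()) ∈ nonunits R by simpa using hu)
    simp [hz] at this
  have hX' : IsUnit (fromBlocks (1 : Matrix Unit Unit R) z₁₂ 0 1 *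
      fromBlocks x₁₁ x₁₂ x₂₁ x₂₂).det := by
    rw [det_mul]
    simpa using hX
  have hY' : IsUnit (fromBlocks (1 : Matrix Unit Unit R) (z₁₂ * B) 0 1 *
      fromBlocks y₁₁ y₁₂ y₂₁ y₂₂).det := by
    rw [det_mul]
    simpa using hY
  -- The row operation passes through `1 ⊕ B`, turning `z₁₂` into `z₁₂B`, so the relation keeps its
  -- shape.
  have h2 : (fromBlocks (1 : Matrix Unit Unit R) z₁₂ 0 1 * fromBlocks x₁₁ x₁₂ x₂₁ x₂₂) *
      fromBlocks 1 0 0 A = fromBlocks 1 0 0 B * (fromBlocks (1 : Matrix Unit Unit R) (z₁₂ * B) 0 1 *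
      fromBlocks y₁₁ y₁₂ y₂₁ y₂₂) := by
    rw [Matrix.mul_assoc, h1, ← Matrix.mul_assoc, ← Matrix.mul_assoc]
    congr 1
    simp [fromBlocks_multiply]
  rw [fromBlocks_multiply] at hX' hY' h2
  rw [fromBlocks_multiply (1 : Matrix Unit Unit R) (z₁₂ * B) 0 1] at h2
  exact of_fromBlocks_mul_eq hX' hY' (by simpa using hw) h2

end AreEquivalent

end AreEquivalent

/-! ### Reduction over `ℤ` and the local-global principle for equivalence. -/

section Int

variable {n : Type*} [Fintype n] [DecidableEq n]

/-- A nonzero integer matrix is equivalent to one with an entry dividing all entries. -/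
theorem exists_areEquivalent_dvd {A : Matrix n n ℤ} (hA : A ≠ 0) :
    ∃ B, AreEquivalent A B ∧ ∃ i j, ∀ k l, B i j ∣ B k l := by
  classical
  have hex : ∃ m : ℕ, m ≠ 0 ∧ ∃ B, AreEquivalent A B ∧ ∃ i j, (B i j).natAbs = m := by
    obtain ⟨i, j, h⟩ : ∃ i j, A i j ≠ 0 := by
      by_contra! h
      exact hA (Matrix.ext h)
    exact ⟨_, by simpa using h, A, .refl A, i, j, rfl⟩
  obtain ⟨hm, B, hB, i, j, hij⟩ := Nat.find_spec hex
  -- The minimum `m` of `|entry|` is taken over all nonzero entries of all matrices equivalent to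
  -- `A`. An entry attaining it divides its row and its column, since otherwise a transvection would
  -- leave a smaller nonzero remainder.
  have hmin : ∀ C, AreEquivalent A C → ∀ k l, (C k l).natAbs < Nat.find hex → C k l = 0 := by
    intro C hC k l hlt
    by_contra h0
    exact Nat.find_min hex hlt ⟨by simpa using h0, C, hC, k, l, rfl⟩
  generalize Nat.find hex = m at hm hij hmin
  have hlt : ∀ x y : ℤ, y.natAbs = m → (x - y * (x / y)).natAbs < m := by
    intro x y hy
    have hy0 : y ≠ 0 := by
      rintro rfl
      exact hm hy.symm
    have h1 := Int.emod_lt_abs x hy0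
    have h2 := Int.emod_nonneg x hy0
    rw [← Int.emod_def]
    zify
    rw [abs_of_nonneg h2, ← hy, Int.natCast_natAbs]
    exact h1
  have row : ∀ C, AreEquivalent A C → ∀ k l l', (C k l).natAbs = m → C k l ∣ C k l' := by
    intro C hC k l l' h
    rcases eq_or_ne l l' with rfl | hl
    · exact dvd_rfl
    have h1 := hmin _ (hC.trans (.mul_transvection C hl (-(C k l' / C k l)))) k l'
    rw [mul_transvection_apply_same] at h1
    have h2 := hlt (C k l') (C k l) h
    exact ⟨C k l' / C k l, by
      have h3 := h1 (by convert h2 using 2; ring)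
      linarith⟩
  have col : ∀ C, AreEquivalent A C → ∀ k l k', (C k l).natAbs = m → C k l ∣ C k' l := by
    intro C hC k l k' h
    rcases eq_or_ne k' k with rfl | hl
    · exact dvd_rfl
    have h1 := hmin _ (hC.trans (.transvection_mul C hl (-(C k' l / C k l)))) k' l
    rw [transvection_mul_apply_same] at h1
    have h2 := hlt (C k' l) (C k l) h
    exact ⟨C k' l / C k l, by
      have h3 := h1 (by convert h2 using 2; ring)
      linarith⟩
  refine ⟨B, hB, i, j, fun k l => ?_⟩
  rcases eq_or_ne k i with rfl | hk
  · exact row B hB _ _ _ hij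
  obtain ⟨q, hq⟩ := col B hB i j k hij
  -- As `B k j = q * B i j`, adding `1 - q` times row `i` to row `k` puts the minimal entry `B i j`
  -- at position `(k, j)`. It then divides the new row `k`, and it already divides row `i`, hence
  -- also the old row `k`.
  have e := hB.trans (.transvection_mul B hk (1 - q))
  have e1 : (transvection k i (1 - q) * B) k j = B i j := by
    rw [transvection_mul_apply_same, hq]
    ring
  have h1 := row _ e k j l (by rw [e1, hij])
  rw [e1, transvection_mul_apply_same] at h1
  exact (dvd_add_left (Dvd.dvd.mul_left (row B hB i j l hij) _)).1 h1

/-- The first step of the reduction to Smith normal form. -/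
theorem exists_areEquivalent_smul_fromBlocks (A : Matrix (Unit ⊕ n) (Unit ⊕ n) ℤ) :
    ∃ (a : ℤ) (A' : Matrix n n ℤ), AreEquivalent A (a • fromBlocks 1 0 0 A') := by
  by_cases hA : A = 0
  · exact ⟨0, 0, by rw [hA, zero_smul]; exact .refl 0⟩
  obtain ⟨B, hB, i, j, h⟩ := exists_areEquivalent_dvd hA
  choose C hC using h
  refine ⟨B i j, _, .trans ?_ ((AreEquivalent.fromBlocks_one
    (of fun _ l => C (Equiv.swap (.inl ()) i (.inl ())) (Equiv.swap (.inl ()) j (.inr l)))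
    (of fun k _ => C (Equiv.swap (.inl ()) i (.inr k)) (Equiv.swap (.inl ()) j (.inl ())))
    (of fun k l => C (Equiv.swap (.inl ()) i (.inr k)) (Equiv.swap (.inl ()) j (.inr l)))).smul _)⟩
  -- Swapping rows and columns moves the pivot to the corner; dividing all entries by it leaves `1`
  -- there.
  convert hB.trans (.submatrix_perm B (Equiv.swap (.inl ()) i) (Equiv.swap (.inl ()) j)) using 1
  ext (k | k) (l | l)
  · simp
  all_goals
    rw [smul_apply, submatrix_apply, smul_eq_mul, hC (Equiv.swap _ _ _)]
    rfl

/-- For `a ≠ 0` the quotient `b / a` is `p`-integral at every `p`, hence an integer. For `a = 0` a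
single prime forces `b = 0`. -/
theorem int_dvd_of_forall_padicInt {a b : ℤ}
    (h : ∀ p : Nat.Primes, (a : ℤ_[p]) ∣ b) : a ∣ b := by
  by_cases ha : a = 0
  · have := h ⟨2, Nat.prime_two⟩
    rw [ha, Int.cast_zero, zero_dvd_iff, Int.cast_eq_zero] at this
    simp [ha, this]
  obtain ⟨z, hz⟩ := HeckeZr.exists_int_of_forall (q := b / a) fun p => by
    obtain ⟨c, hc⟩ := h p
    have ha' : (a : ℚ_[p]) ≠ 0 := Int.cast_ne_zero.2 ha
    have hc' : (b : ℚ_[p]) = a * c := by exact_mod_cast congrArg ((↑) : ℤ_[p] → ℚ_[p]) hc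
    have : algebraMap ℚ ℚ_[p] (b / a) = c := by
      rw [map_div₀, map_intCast, map_intCast, hc', mul_div_cancel_left₀ _ ha']
    rw [this]
    exact c.2
  refine ⟨z, ?_⟩
  have ha' : (a : ℚ) ≠ 0 := Int.cast_ne_zero.2 ha
  rw [eq_div_iff ha'] at hz
  rw [mul_comm]
  exact_mod_cast hz.symm

/-- Integer matrices that are equivalent over `ℤ_p` for all primes `p` are equivalent. -/
theorem areEquivalent_of_forall_padicInt : ∀ {r : ℕ} {A B : Matrix (Fin r) (Fin r) ℤ},
    (∀ p : Nat.Primes, AreEquivalent ((Int.castRingHom ℤ_[p]).mapMatrix A)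
      ((Int.castRingHom ℤ_[p]).mapMatrix B)) → AreEquivalent A B
  | 0, A, B, _ => by
    rw [Subsingleton.elim A B]
    exact .refl B
  | r + 1, A, B, h => by
    let e : Unit ⊕ Fin r ≃ Fin (r + 1) :=
      (Equiv.sumComm _ _).trans ((Equiv.optionEquivSumPUnit _).symm.trans (finSuccEquiv r).symm)
    obtain ⟨a, A', hA⟩ := exists_areEquivalent_smul_fromBlocks (A.submatrix e e)
    obtain ⟨b, B', hB⟩ := exists_areEquivalent_smul_fromBlocks (B.submatrix e e)
    suffices hAB : AreEquivalent (A.submatrix e e) (B.submatrix e e) by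
      simpa using hAB.submatrix e.symm
    have hmap : ∀ (p : Nat.Primes) (c : ℤ) (C : Matrix (Fin r) (Fin r) ℤ),
        (Int.castRingHom ℤ_[p]).mapMatrix (c • fromBlocks (1 : Matrix Unit Unit ℤ) 0 0 C) =
          (c : ℤ_[p]) • fromBlocks 1 0 0 ((Int.castRingHom ℤ_[p]).mapMatrix C) := by
      intro p c C
      rw [RingHom.mapMatrix_smul]
      congr 1
      ext (i | i) (j | j) <;> simp
    have hloc : ∀ p : Nat.Primes, AreEquivalent
        ((a : ℤ_[p]) • fromBlocks (1 : Matrix Unit Unit ℤ_[p]) 0 0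
          ((Int.castRingHom ℤ_[p]).mapMatrix A'))
        ((b : ℤ_[p]) • fromBlocks (1 : Matrix Unit Unit ℤ_[p]) 0 0
          ((Int.castRingHom ℤ_[p]).mapMatrix B')) := by
      intro p
      rw [← hmap, ← hmap]
      exact (hA.map _).symm.trans (((h p).submatrix e).trans (hB.map _))
    -- Divisibility of all entries is invariant under equivalence, and the corner entry of `b • (1 ⊕
    -- B')` is `b` itself.
    have hab : a ∣ b := int_dvd_of_forall_padicInt fun p => by
      simpa using (hloc p).dvd (fun i j => Dvd.intro _ rfl) (.inl ()) (.inl ())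
    have hba : b ∣ a := int_dvd_of_forall_padicInt fun p => by
      simpa using (hloc p).symm.dvd (fun i j => Dvd.intro _ rfl) (.inl ()) (.inl ())
    refine hA.trans (.trans ?_ hB.symm)
    by_cases ha : a = 0
    · rw [ha, zero_dvd_iff] at hab
      rw [ha, hab, zero_smul, zero_smul]
      exact .refl 0
    obtain ⟨u, rfl⟩ := associated_of_dvd_dvd hab hba
    -- The unit `u` is absorbed into an invertible factor, so that both sides carry the same scalar
    -- `a`, which cancels in the domain `ℤ_p`.
    have hneg : AreEquivalent (a • fromBlocks (1 : Matrix Unit Unit ℤ) 0 0 B')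
        ((a * u) • fromBlocks 1 0 0 B') := by
      have h1 := AreEquivalent.smul_unit (a • fromBlocks (1 : Matrix Unit Unit ℤ) 0 0 B') u
      rwa [smul_smul, mul_comm] at h1
    refine .trans (.smul ?_ a) hneg
    obtain ⟨P, Q, hP, hQ, hPQ⟩ := areEquivalent_of_forall_padicInt (A := A') (B := B') fun p =>
      .of_fromBlocks_one <| .of_smul (a := (a : ℤ_[p])) (Int.cast_ne_zero.2 ha) <| by
        have h1 := (hneg.map (Int.castRingHom ℤ_[p])).symm
        rw [hmap, hmap] at h1
        exact (hloc p).trans h1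
    exact ⟨fromBlocks 1 0 0 P, fromBlocks 1 0 0 Q, by simpa using hP, by simpa using hQ,
      by simp [fromBlocks_multiply, hPQ]⟩

end Int

end Matrix

/-! ### Approximation by integer matrices and class number one. -/

namespace HeckeZr

open Matrix IntegralMatrices Filter RestrictedProduct
open scoped MatrixGroups

/-- The prime-to-`p` part of `n` is a unit of `ℤ_p`. -/
theorem dvd_padicInt_of_dvd {p : Nat.Primes} {n : ℕ} (hn : n ≠ 0) {x : ℤ_[p]}
    (h : (p : ℤ_[p]) ^ n.factorization p ∣ x) : (n : ℤ_[p]) ∣ x := by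
  have hu : IsUnit ((n / (p : ℕ) ^ n.factorization p : ℕ) : ℤ_[p]) := by
    rw [PadicInt.isUnit_iff]
    refine le_antisymm (PadicInt.norm_le_one _) (not_lt.1 fun hlt => ?_)
    rw [PadicInt.norm_natCast_lt_one_iff] at hlt
    exact (Nat.Prime.coprime_iff_not_dvd p.2).1 (Nat.coprime_ordCompl p.2 hn) hlt
  rw [← Nat.ordProj_mul_ordCompl_eq_self n p, Nat.cast_mul, Nat.cast_pow]
  exact hu.mul_right_dvd.2 h

/-- The Chinese remainder theorem for a family of `p`-adic integers. -/
theorem exists_int_forall_dvd_sub (a : ∀ p : Nat.Primes, ℤ_[p]) {n : ℕ} (hn : n ≠ 0) :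
    ∃ b : ℤ, ∀ p : Nat.Primes, (n : ℤ_[p]) ∣ b - a p := by
  have hfin : Finite {p : Nat.Primes // (p : ℕ) ∣ n} :=
    Finite.of_injective (β := n.divisors)
      (fun p => ⟨(p : Nat.Primes), Nat.mem_divisors.2 ⟨p.2, hn⟩⟩)
      fun p q h => by
        rw [Subtype.mk.injEq] at h
        exact Subtype.ext (Nat.Primes.coe_nat_injective h)
  obtain ⟨b, hb⟩ := Ideal.exists_forall_sub_mem_ideal
    (I := fun p : {p : Nat.Primes // (p : ℕ) ∣ n} =>
      Ideal.span {((p : ℕ) : ℤ) ^ n.factorization p})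
    (fun p q hpq => by
      rw [Function.onFun, Ideal.isCoprime_span_singleton_iff]
      refine IsCoprime.pow (Nat.isCoprime_iff_coprime.2 ?_)
      refine (Nat.coprime_primes p.1.2 q.1.2).2 fun h => hpq ?_
      exact Subtype.ext (Nat.Primes.coe_nat_injective h))
    -- Only the primes dividing `n` impose a condition. There `a p` is replaced by an integer
    -- congruent to it modulo the `p`-part of `n`.
    (fun p => ((a p).appr (n.factorization p) : ℤ))
  refine ⟨b, fun p => dvd_padicInt_of_dvd hn ?_⟩
  by_cases hp : (p : ℕ) ∣ n
  · have h1 := map_dvd (Int.castRingHom ℤ_[p]) (Ideal.mem_span_singleton.1 (hb ⟨p, hp⟩))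
    have h2 := Ideal.mem_span_singleton.1 (PadicInt.appr_spec (n.factorization p) (a p))
    simp only [map_pow, map_sub, eq_intCast, Int.cast_natCast] at h1
    simpa using dvd_sub h1 h2
  · rw [Nat.factorization_eq_zero_of_not_dvd hp, pow_zero]
    exact one_dvd _

variable {r : ℕ}

/-- Some positive integer `n` makes `n α⁻¹` integral, for all `p`. -/
theorem exists_nat_smul_inv {α : GHat r} (hα : α ∈ DelHat r) :
    ∃ n : ℕ, n ≠ 0 ∧ ∀ p : Nat.Primes, ∃ N : Matrix (Fin r) (Fin r) ℤ_[p],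
      (algebraMap ℤ_[p] ℚ_[p]).mapMatrix N = (n : ℚ_[p]) • ((α p)⁻¹).val := by
  have hloc : ∀ p : Nat.Primes, ∃ k : ℕ, ∃ N : Matrix (Fin r) (Fin r) ℤ_[p],
      (algebraMap ℤ_[p] ℚ_[p]).mapMatrix N = ((p : ℕ) ^ k : ℚ_[p]) • ((α p)⁻¹).val := by
    intro p
    obtain ⟨s, hs, N, hN⟩ := exists_smul_inv (mem_prodSubmonoid.1 hα p)
    refine ⟨s.valuation, ((PadicInt.unitCoeff hs)⁻¹ : ℤ_[p]ˣ).val • N, ?_⟩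
    have h1 : ((p : ℕ) ^ s.valuation : ℚ_[p]) =
        algebraMap ℤ_[p] ℚ_[p] (((PadicInt.unitCoeff hs)⁻¹ : ℤ_[p]ˣ).val * s) := by
      have h2 : ((PadicInt.unitCoeff hs)⁻¹ : ℤ_[p]ˣ).val * s = ((p : ℕ) : ℤ_[p]) ^ s.valuation :=
        (Units.inv_mul_eq_iff_eq_mul _).2 (PadicInt.unitCoeff_spec hs)
      rw [h2, map_pow, map_natCast]
    rw [h1, map_mul, ← smul_smul, ← hN, RingHom.mapMatrix_smul]
  choose k N hN using hloc
  have hfin : {p | α p ∉ GamP r p}.Finite := α.2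
  -- Outside the finite set where `α p ∉ Γ_p` the inverse is already integral; inside it, the factor
  -- `p ^ k p` clears the denominators.
  refine ⟨∏ p ∈ hfin.toFinset, (p : ℕ) ^ k p,
    Finset.prod_ne_zero_iff.2 fun p _ => pow_ne_zero _ p.2.ne_zero, fun p => ?_⟩
  by_cases hp : α p ∈ GamP r p
  · obtain ⟨M, hM⟩ := mem_integralMonoid.1 (mem_integralGL.1 hp).2
    generalize ∏ p ∈ hfin.toFinset, (p : ℕ) ^ k p = n
    refine ⟨(n : ℤ_[p]) • M, ?_⟩
    rw [← hM, RingHom.mapMatrix_smul, map_natCast]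
  · obtain ⟨c, hc⟩ := Finset.dvd_prod_of_mem (fun q : Nat.Primes => (q : ℕ) ^ k q)
      (hfin.mem_toFinset.2 hp)
    refine ⟨(c : ℤ_[p]) • N p, ?_⟩
    rw [hc, Nat.cast_mul, Nat.cast_pow, mul_comm, ← smul_smul, ← hN, RingHom.mapMatrix_smul,
      map_natCast]

/-- A basis of the lattice spanned by the rows of `B` and by `n ℤ^r`. -/
theorem exists_basis_of_rows (B : Matrix (Fin r) (Fin r) ℤ) {n : ℤ} (hn : n ≠ 0) :
    ∃ g X Y U V : Matrix (Fin r) (Fin r) ℤ, g = X * B + n • Y ∧ B = U * g ∧ n • 1 = V * g := by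
  let φ : (Fin r → ℤ) × (Fin r → ℤ) →ₗ[ℤ] (Fin r → ℤ) :=
    LinearMap.coprod (vecMulLinear B) (n • LinearMap.id)
  have hφ : ∀ x y, φ (x, y) = x ᵥ* B + n • y := fun x y => rfl
  have hrank : Module.finrank ℤ (LinearMap.range φ) = r := by
    refine le_antisymm ?_ ?_
    · simpa using Submodule.finrank_le (LinearMap.range φ)
    -- The lattice contains `nℤ^r`, so it has full rank because `n ≠ 0`.
    · have hinj : Function.Injective (φ.rangeRestrict ∘ₗ LinearMap.inr ℤ _ _) := by
        intro x y h
        have h1 := congrArg Subtype.val h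
        change φ (0, x) = φ (0, y) at h1
        rw [hφ, hφ, zero_vecMul, zero_add, zero_add] at h1
        exact smul_right_injective _ hn h1
      simpa using LinearMap.finrank_le_finrank_of_injective hinj
  let b := Module.finBasisOfFinrankEq ℤ (LinearMap.range φ) hrank
  let g : Matrix (Fin r) (Fin r) ℤ := of fun i => (b i : Fin r → ℤ)
  have hrow : ∀ i, ∃ x y, x ᵥ* B + n • y = g i := by
    intro i
    obtain ⟨⟨x, y⟩, h⟩ := (b i).2
    exact ⟨x, y, h⟩
  have hspan : ∀ x y, ∃ c, c ᵥ* g = x ᵥ* B + n • y := by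
    intro x y
    refine ⟨b.equivFun ⟨φ (x, y), (x, y), rfl⟩, ?_⟩
    have h := congrArg Subtype.val (b.sum_equivFun ⟨φ (x, y), (x, y), rfl⟩)
    rw [AddSubmonoidClass.coe_finsetSum] at h
    rw [← hφ, vecMul_eq_sum]
    exact h
  choose X Y hXY using hrow
  choose c hc using hspan
  -- Rows of `U` and `V` are the coordinates of the rows of `B` and of the vectors `n e_i` in the
  -- chosen basis.
  refine ⟨g, of X, of Y, of fun i => c (Pi.single i 1) 0, of fun i => c 0 (Pi.single i 1), ?_, ?_, ?_⟩
  · ext i j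
    rw [← hXY i]
    rfl
  · ext i j
    have := congrFun (hc (Pi.single i 1) 0) j
    rw [single_one_vecMul, smul_zero, add_zero] at this
    exact this.symm
  · ext i j
    have := congrFun (hc 0 (Pi.single i 1)) j
    rw [zero_vecMul, zero_add] at this
    refine Eq.trans ?_ this.symm
    simp [Matrix.one_apply, Pi.single_apply, eq_comm]

/-- The class number of `GL_r` over `ℚ` is one, for integral matrices. -/
theorem exists_mul_eta_inv_mem {α : GHat r} (hα : α ∈ DelHat r) :
    ∃ g ∈ Del r, α * (eta r g)⁻¹ ∈ GamHat r := by
  obtain ⟨n, hn, hN⟩ := exists_nat_smul_inv hα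
  choose N hN using hN
  choose A hA using fun p => mem_integralMonoid.1 (mem_prodSubmonoid.1 hα p)
  choose B hB using fun i j => exists_int_forall_dvd_sub (fun p => A p i j) hn
  choose M hM using hB
  -- `B ≡ A p` modulo `n`, and `N p * A p = n` puts `nℤ_p^r` inside the row lattice of `A p`. So the
  -- rows of `g` span over `ℤ_p` the same lattice as those of `A p`; `hgA` and `hAg` below give the
  -- two transition matrices, which are mutually inverse.
  obtain ⟨g, X, Y, U, V, hg, hU, hV⟩ := exists_basis_of_rows (of B) (Nat.cast_ne_zero.2 hn)
  have hdet : ((algebraMap ℤ ℚ).mapMatrix g).det ≠ 0 := by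
    have h1 := congrArg det hV
    rw [det_smul, det_one, mul_one, det_mul] at h1
    rw [← RingHom.map_det]
    refine (map_ne_zero_iff _ Int.cast_injective).2 fun h0 => ?_
    rw [h0, mul_zero] at h1
    exact pow_ne_zero _ (Nat.cast_ne_zero.2 hn) h1
  refine ⟨GeneralLinearGroup.mkOfDetNeZero _ hdet, mem_integralMonoid.2 ⟨g, rfl⟩,
    mem_prodSubgroup.2 fun p => ?_⟩
  let f : Matrix (Fin r) (Fin r) ℤ →+* Matrix (Fin r) (Fin r) ℤ_[p] :=
    (Int.castRingHom ℤ_[p]).mapMatrix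
  have hf : ∀ C, f ((n : ℤ) • C) = (n : ℤ_[p]) • f C := by
    intro C
    simp only [f, RingHom.mapMatrix_smul, map_natCast]
  have hinj := mapMatrix_injective (r := r) (A := ℤ_[p]) (K := ℚ_[p])
  have hNA : N p * A p = (n : ℤ_[p]) • 1 := by
    apply hinj
    rw [map_mul, hN, hA, smul_mul_assoc, ← Units.val_mul, inv_mul_cancel]
    ext i j
    by_cases h : i = j <;> simp [h]
  have hBA : f (of B) = A p + (n : ℤ_[p]) • of fun i j => M i j p := by
    ext i j
    have := hM i j p
    rw [sub_eq_iff_eq_add'] at this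
    simpa [f] using this
  have hgA : f g = (f X + (f X * (of fun i j => M i j p) + f Y) * N p) * A p := by
    rw [hg, map_add, map_mul, hf, hBA, add_mul, mul_assoc _ (N p), hNA]
    simp only [mul_add, smul_add, mul_smul_comm, mul_one, add_assoc]
  have hAg : A p = (f U - (of fun i j => M i j p) * f V) * f g := by
    rw [sub_mul, mul_assoc, ← map_mul, ← map_mul, ← hU, ← hV, hf, hBA]
    simp
  have hη : (eta r (GeneralLinearGroup.mkOfDetNeZero _ hdet) p).val =
      (algebraMap ℤ_[p] ℚ_[p]).mapMatrix (f g) := by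
    ext i j
    simp [eta_apply, GeneralLinearGroup.map_apply, GeneralLinearGroup.mkOfDetNeZero, f]
  generalize eta r (GeneralLinearGroup.mkOfDetNeZero _ hdet) = γ at hη
  refine mem_integralGL.2 ⟨mem_integralMonoid.2 ⟨f U - (of fun i j => M i j p) * f V, ?_⟩,
    mem_integralMonoid.2 ⟨f X + (f X * (of fun i j => M i j p) + f Y) * N p, ?_⟩⟩
  · change _ = (α p).val * ((γ p)⁻¹).val
    rw [← hA, hAg, map_mul, ← hη, mul_assoc, ← Units.val_mul, mul_inv_cancel, Units.val_one, mul_one]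
  · change _ = ((α p * (γ p)⁻¹)⁻¹).val
    rw [_root_.mul_inv_rev, inv_inv, Units.val_mul, hη, hgA, map_mul, hA, mul_assoc, ← Units.val_mul,
      mul_inv_cancel, Units.val_one, mul_one]

end HeckeZr

/-! ### Comparison of cosets, double cosets and convolutions. -/

namespace HeckeZr

open Matrix IntegralMatrices Filter RestrictedProduct
open scoped MatrixGroups

variable {r : ℕ}

theorem eta_mem_DelHat_iff {g : GL (Fin r) ℚ} : eta r g ∈ DelHat r ↔ g ∈ Del r := by
  refine ⟨fun h => ?_, eta_mem_DelHat⟩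
  have key : ∀ i j, ∃ z : ℤ, (z : ℚ) = g.val i j := fun i j =>
    exists_int_of_forall fun p => mem_DelP.1 (mem_prodSubmonoid.1 h p) i j
  choose M hM using key
  exact mem_integralMonoid.2 ⟨of M, by ext i j; exact hM i j⟩

theorem eta_mem_GamHat_iff {g : GL (Fin r) ℚ} : eta r g ∈ GamHat r ↔ g ∈ Gam r := by
  refine ⟨fun h => mem_integralGL.2 ⟨?_, ?_⟩, eta_mem_GamHat⟩
  · exact eta_mem_DelHat_iff.1 (IsHeckeTriple.mem_of_mem_left (H₁ := GamHat r) (GamHat r) h)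
  · refine eta_mem_DelHat_iff.1 (IsHeckeTriple.mem_of_mem_left (H₁ := GamHat r) (GamHat r) ?_)
    rw [map_inv]
    exact inv_mem h

theorem etaCoset_mk (g : Del r) : etaCoset r (HeckeCoset.mk _ _ g) =
    HeckeCoset.mk _ _ (⟨eta r g, eta_mem_DelHat g.2⟩ : DelHat r) := rfl

theorem etaCoset_surjective : Function.Surjective (etaCoset r) := by
  intro D
  obtain ⟨g, hg, h⟩ := exists_mul_eta_inv_mem (HeckePair.rep D).2
  refine ⟨HeckeCoset.mk _ _ ⟨g, hg⟩, ?_⟩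
  rw [← HeckePair.mk_rep D, etaCoset_mk]
  exact HeckePair.mk_eq_mk.2 ⟨_, h, 1, one_mem _, by simp⟩

theorem etaCoset_injective : Function.Injective (etaCoset r) := by
  intro D E h
  rw [← HeckePair.mk_rep D, ← HeckePair.mk_rep E] at h ⊢
  generalize HeckePair.rep D = a, HeckePair.rep E = b at h
  obtain ⟨A, hA⟩ := mem_integralMonoid.1 a.2
  obtain ⟨B, hB⟩ := mem_integralMonoid.1 b.2
  rw [etaCoset_mk, etaCoset_mk] at h
  obtain ⟨x, hx, y, hy, e⟩ := HeckePair.mk_eq_mk.1 h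
  have hAB : AreEquivalent A B := areEquivalent_of_forall_padicInt fun p => by
    obtain ⟨X, hX⟩ := mem_prodSubgroup.1 hx p
    obtain ⟨Y, hY⟩ := mem_prodSubgroup.1 hy p
    refine ⟨X.val, Y.val, (isUnit_iff_isUnit_det _).1 X.isUnit, (isUnit_iff_isUnit_det _).1 Y.isUnit,
      mapMatrix_injective (K := ℚ_[p]) ?_⟩
    have e1 : eta r b p = x p * eta r a p * y p := by
      rw [show eta r b = x * eta r a * y from e]
      rfl
    have cast : ∀ (C : Matrix (Fin r) (Fin r) ℤ) (c : GL (Fin r) ℚ),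
        (algebraMap ℤ ℚ).mapMatrix C = c.val → (algebraMap ℤ_[p] ℚ_[p]).mapMatrix
          ((Int.castRingHom ℤ_[p]).mapMatrix C) = (eta r c p).val := by
      intro C c h
      ext i j
      rw [eta_apply, GeneralLinearGroup.map_apply, ← h]
      simp
    rw [map_mul, map_mul, cast A a hA, cast B b hB, e1, ← hX, ← hY]
    rfl
  obtain ⟨P, Q, hP, hQ, rfl⟩ := hAB
  refine HeckePair.mk_eq_mk.2 ⟨_, ⟨GeneralLinearGroup.mk'' P hP, rfl⟩, _,
    ⟨GeneralLinearGroup.mk'' Q hQ, rfl⟩, Units.ext ?_⟩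
  rw [← hB, map_mul, map_mul, hA]
  rfl

theorem etaStar_apply (F : RHat r) (D : HeckeCoset (Del r) (Gam r) (Gam r)) :
    etaStar r F D = F (etaCoset r D) := rfl

/-- On functions on the groups, `η^*` is composition with `η`; outside `Δ` both sides vanish because
`η⁻¹(Δ̂) = Δ`. -/
theorem toFun_etaStar (F : RHat r) (g : GL (Fin r) ℚ) :
    HeckePair.toFun (etaStar r F) g = HeckePair.toFun F (eta r g) := by
  by_cases h : g ∈ Del r
  · simp only [HeckePair.toFun, dif_pos h, dif_pos (eta_mem_DelHat h)]
    rfl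
  · simp only [HeckePair.toFun, dif_neg h, dif_neg (mt eta_mem_DelHat_iff.1 h)]

/-- The map `Γ\GL_r(ℚ) → Γ̂\GL_r(𝔸_f)` induced by `η`. -/
noncomputable def etaRight (c : HeckePair.RightCosets (Gam r)) : HeckePair.RightCosets (GamHat r) :=
  HeckePair.cosetMk (GamHat r) (eta r c.out)

theorem etaRight_injective : Function.Injective (etaRight (r := r)) := by
  intro c d h
  unfold etaRight at h
  rw [HeckePair.cosetMk_eq, ← map_inv, ← map_mul, eta_mem_GamHat_iff,
    ← HeckePair.cosetMk_eq] at h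
  rwa [HeckePair.cosetMk_out, HeckePair.cosetMk_out] at h

theorem mem_range_etaRight {c : HeckePair.RightCosets (GamHat r)} (hc : c.out ∈ DelHat r) :
    c ∈ Set.range (etaRight (r := r)) := by
  obtain ⟨g, -, h⟩ := exists_mul_eta_inv_mem hc
  refine ⟨HeckePair.cosetMk (Gam r) g, ?_⟩
  obtain ⟨γ, hγ, e⟩ := HeckePair.out_mk (Γ := Gam r) g
  rw [← HeckePair.cosetMk_out c, etaRight, HeckePair.cosetMk_eq, e, map_mul, _root_.mul_inv_rev,
    ← mul_assoc]
  exact mul_mem h (inv_mem (eta_mem_GamHat hγ))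

/-- Sums over `Γ̂\Δ̂` are sums over `Γ\Δ`. -/
theorem cosetSum_eta {φ : GHat r → ℤ} (hφ : ∀ γ ∈ GamHat r, ∀ g, φ (γ * g) = φ g)
    (hsupp : ∀ g, φ g ≠ 0 → g ∈ DelHat r) :
    HeckePair.cosetSum (Gam r) (fun b => φ (eta r b)) = HeckePair.cosetSum (GamHat r) φ := by
  unfold HeckePair.cosetSum
  have h1 : ∀ c : HeckePair.RightCosets (Gam r), φ (eta r c.out) = φ (etaRight c).out :=
    fun c => (HeckePair.apply_out hφ _).symm
  rw [finsum_congr h1, ← finsum_mem_range (f := fun c => φ c.out) etaRight_injective,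
    ← finsum_mem_univ fun c : HeckePair.RightCosets (GamHat r) => φ c.out]
  -- Cosets outside the image of `etaRight` do not meet `Δ̂`, so `φ` vanishes on them.
  refine finsum_mem_inter_support_eq _ _ _ ?_
  ext c
  simp only [Set.mem_inter_iff, Set.mem_univ, true_and, Function.mem_support]
  exact ⟨And.right, fun h => ⟨mem_range_etaRight (hsupp _ h), h⟩⟩

/-- The summand `b ↦ F(η(ξ)b⁻¹)H(b)` is left `Γ̂`-invariant and supported in `Δ̂`, so its sum may be
taken over `Γ\Δ`. Injectivity on double cosets plays no role here. -/
theorem etaStar_mul (F H : RHat r) : etaStar r (F * H) = etaStar r F * etaStar r H := by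
  refine HeckePair.toFun_injective (funext fun ξ => ?_)
  rw [toFun_etaStar, HeckePair.toFun_mul, HeckePair.toFun_mul]
  unfold HeckePair.conv
  have hF := HeckePair.isHecke_toFun F
  have hH := HeckePair.isHecke_toFun H
  rw [← cosetSum_eta (hF.summand hH _) fun g hg => hH.supp g (right_ne_zero_of_mul hg)]
  simp only [toFun_etaStar, map_mul, map_inv]

theorem etaStar_injective : Function.Injective (etaStar r) := by
  intro F H h
  ext D
  obtain ⟨E, rfl⟩ := etaCoset_surjective D
  rw [← etaStar_apply, h, etaStar_apply]

theorem etaStar_surjective : Function.Surjective (etaStar r) := by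
  intro F
  let e := Equiv.ofBijective (etaCoset r) ⟨etaCoset_injective, etaCoset_surjective⟩
  refine ⟨HeckeCosetModule.of ((HeckeCosetModule.of.symm F).equivMapDomain e), ?_⟩
  ext D
  exact congrArg (HeckeCosetModule.of.symm F) (e.symm_apply_apply D)

end HeckeZr

theorem proposition3 (r : ℕ) (hr : 0 < r) :
    ∃ e : HeckeZr.RHat r ≃+* HeckeZr.R r, ∀ F : HeckeZr.RHat r, e F = HeckeZr.etaStar r F :=
  ⟨{ AddEquiv.ofBijective (HeckeZr.etaStar r)
      ⟨HeckeZr.etaStar_injective, HeckeZr.etaStar_surjective⟩ with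
      map_mul' := HeckeZr.etaStar_mul }, fun _ => rfl⟩
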